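/- Let $\beta>0$, and let $(\mu_n)_{n\ge 1}$ be a sequence of nonnegative real numbers such that $\mu_n/n\to c$ as $n\to\infty$. For $\delta\ge 0$ put $$Q_\delta(x)=x^2+2\delta\log\frac1{|x|}\qquad(x\in\mathbb R),$$ with $Q_\delta(0)=+\infty$ if $\delta>0$ and $Q_0(0)=0$. For a probability measure $\nu$ on $\mathbb R$ let $$E_{\beta,c}(\nu)=\frac\beta2\int_{\mathbb R^2}\log\frac1{|s-t|}\,\nu(ds)\,\nu(dt)+\int_{\mathbb R}Q_c(t)\,\nu(dt)\in(-\infty,+\infty],$$ where $\log\frac10=+\infty$ and where $E_{\beta,c}(\nu)=+\infty$ if $\int\log(1+|t|)\,\nu(dt)=+\infty$, and let $E^*_{\beta,c}=\inf_\nu E_{\beta,c}(\nu)$, the infimum being over all probability measures $\nu$ on $\mathbb R$. With $\alpha_n=\mu_n/n$, define on $\mathbb R^n$ the function $$K_n(x)=\frac\beta2\sum_{i\ne j}\log\frac1{|x_i-x_j|}+(n-1)\sum_{i=1}^nQ_{\alpha_n}(x_i)\in(-\infty,+\infty]$$ (for $n=1$ this is $K_1=0$) and the probability measure $$\mathbb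 P_{n,\mu_n}(dx)=\frac1{Z_n}\,e^{-n\sum_{i=1}^nx_i^2}\prod_{i=1}^n|x_i|^{2\mu_n}\prod_{1\le i<j\le n}|x_i-x_j|^\beta\,dx_1\cdots dx_n ,$$ where $Z_n$ is the normalizing constant. For $\varepsilon>0$ let $$A_{n,\varepsilon}=\{x\in\mathbb R^n : K_n(x)\le (E^*_{\beta,c}+\varepsilon)\,n^2\}.$$ Then, for every $\varepsilon>0$, the set $A_{n,\varepsilon}$ is compact for every $n\ge 2$, and $$\lim_{n\to\infty}\mathbb P_{n,\mu_n}(A_{n,\varepsilon})=1 .$$ -/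

import Mathlib

open MeasureTheory Filter Topology
open scoped ENNReal

noncomputable section

namespace ChiralEnsemble

/-- `log (1 / |x|)` with values in `(-∞, +∞]`; the value at `x = 0` is `+∞`. -/
def logInv (x : ℝ) : EReal :=
  if x = 0 then ⊤ else ((Real.log (1 / |x|) : ℝ) : EReal)

/-- The potential `Q_c(x) = x² + 2 c log (1 / |x|)`, with values in `(-∞, +∞]` for `c ≥ 0`.
(In `EReal` one has `0 * ⊤ = 0`, so that `Q_0(x) = x²` everywhere.) -/
def potential (c x : ℝ) : EReal :=
  ((x ^ 2 : ℝ) : EReal) + ((2 * c : ℝ) : EReal) * logInv x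

/-- The integral of an extended-real function: integral of the positive part minus integral of
the negative part. It is used only for functions whose negative part has finite integral. -/
def extIntegral {X : Type*} [MeasurableSpace X] (m : Measure X) (f : X → EReal) : EReal :=
  ((∫⁻ x, (f x).toENNReal ∂m : ℝ≥0∞) : EReal) - ((∫⁻ x, (-f x).toENNReal ∂m : ℝ≥0∞) : EReal)

open Classical in
/-- The energy
`E_{β,c}(ν) = (β/2) ∬ log (1 / |s - t|) ν(ds) ν(dt) + ∫ Q_c(t) ν(dt)` in `(-∞, +∞]`.
If `∫ log (1 + |t|) ν(dt) < ∞`, both integrals are well defined in `(-∞, +∞]` (for `c ≥ 0`).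
Otherwise `∫ Q_c dν = +∞`, and the energy is `+∞`; this is also the value of the double integral
of the kernel `(β/2) log (1 / |s - t|) + Q_c(s) / 2 + Q_c(t) / 2`, which is bounded below. -/
def energy (β c : ℝ) (ν : Measure ℝ) : EReal :=
  if Integrable (fun t : ℝ => Real.log (1 + |t|)) ν then
    ((β / 2 : ℝ) : EReal) * extIntegral (ν.prod ν) (fun p : ℝ × ℝ => logInv (p.1 - p.2))
      + extIntegral ν (potential c)
  else ⊤

/-- The minimal energy `E*_{β,c}`: the infimum of `E_{β,c}` over all probability measures on
the real line. -/
def minEnergy (β c : ℝ) : EReal :=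
  ⨅ ν : ProbabilityMeasure ℝ, energy β c (ν : Measure ℝ)

/-- `K_n(x) = (β/2) ∑_{i ≠ j} log (1 / |x_i - x_j|) + (n - 1) ∑_i Q_{μ/n}(x_i)`, where the first
sum is over ordered pairs; the values are in `(-∞, +∞]` for `β > 0`, `μ ≥ 0`, `n ≥ 1`. -/
def K (β μ : ℝ) (n : ℕ) (x : Fin n → ℝ) : EReal :=
  ((β / 2 : ℝ) : EReal) *
      ∑ p ∈ (Finset.univ : Finset (Fin n)).offDiag, logInv (x p.1 - x p.2)
    + (((n : ℝ) - 1 : ℝ) : EReal) * ∑ i, potential (μ / n) (x i)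

/-- The sublevel set `A_{n,ε} = {x ∈ ℝⁿ | K_n(x) ≤ (E*_{β,c} + ε) n²}`. -/
def sublevel (β c μ ε : ℝ) (n : ℕ) : Set (Fin n → ℝ) :=
  {x | K β μ n x ≤ (minEnergy β c + (ε : EReal)) * (((n : ℝ) ^ 2 : ℝ) : EReal)}

/-- The unnormalized density
`e^{-n ∑ x_i²} ∏_i |x_i|^{2μ} ∏_{i < j} |x_i - x_j|^β` on `ℝⁿ`. -/
def weight (β μ : ℝ) (n : ℕ) (x : Fin n → ℝ) : ℝ :=
  Real.exp (-(n : ℝ) * ∑ i, x i ^ 2) * (∏ i, |x i| ^ (2 * μ))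
    * ∏ i, ∏ j ∈ Finset.Ioi i, |x i - x j| ^ β

/-- The normalizing constant `Z_n`, the integral of the density over `ℝⁿ`. -/
def partitionFunction (β μ : ℝ) (n : ℕ) : ℝ≥0∞ :=
  ∫⁻ x : Fin n → ℝ, ENNReal.ofReal (weight β μ n x)

/-- The measure `P_{n,μ}` on `ℝⁿ` with density `weight / Z_n` for Lebesgue measure. -/
def ensemble (β μ : ℝ) (n : ℕ) : Measure (Fin n → ℝ) :=
  (partitionFunction β μ n)⁻¹ •
    (volume : Measure (Fin n → ℝ)).withDensity (fun x => ENNReal.ofReal (weight β μ n x))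

end ChiralEnsemble

end

/-! The density is `e^{-K_n}` times one factor `e^{-Q_α(x_i)}` per coordinate, with `α = μ_n / n`
(`weight_eq`), because `K_n` carries `n - 1` copies of the potential and the density carries `n`.
Off the sublevel set `e^{-K_n}` is below `e^{-(E* + ε) n²}`, and the leftover factors integrate to
at most `C^n`. So the unnormalized mass of the complement is at most `C^n e^{-(E* + ε) n²}`
(`setLIntegral_weight_le`).

It remains to bound `Z_n` from below by `e^{-a n² - O(n)}` for some `a < E* + ε`. If a probability
measure `ν` has Lebesgue density at most `M`, then `ν^{⊗n} ≤ M^n dx`, and Jensen's inequality under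
`ν^{⊗n}` gives `Z_n ≥ M^{-n} exp(-n² E(ν) - O(n))`, where `E(ν)` is taken with parameter `α`
(`le_partitionFunction`). A near-minimizer need not have a bounded density; adding a small
independent uniform variable gives it one and raises the energy by an arbitrarily small amount
(`exists_realEnergy_smooth_lt`). Since `α → c`, the ratio of the two bounds tends to `0`.

Compactness holds because `e^{-K_n}` is continuous and, for `n ≥ 2`, has Gaussian decay
(`gibbs_le`): the quadratic potential beats the logarithmic growth of the interaction. -/

noncomputable section

namespace ChiralEnsemble

/-! ### Exponential form of the energy: extended-real sums become real products. -/

/-- `-log a` in `(-∞, +∞]` for `a ≥ 0`, with value `+∞` at `a = 0`. -/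
def negLog (a : ℝ) : EReal := if a = 0 then ⊤ else ((-Real.log a : ℝ) : EReal)

theorem negLog_ne_bot (a : ℝ) : negLog a ≠ ⊥ := by
  unfold negLog
  split_ifs
  · simp
  · exact EReal.coe_ne_bot _

theorem negLog_mul (a b : ℝ) : negLog (a * b) = negLog a + negLog b := by
  by_cases ha : a = 0
  · subst ha
    rw [zero_mul]
    conv_rhs => rw [negLog, if_pos rfl, EReal.top_add_of_ne_bot (negLog_ne_bot b)]
    simp [negLog]
  by_cases hb : b = 0
  · subst hb
    rw [mul_zero]
    conv_rhs => rw [add_comm, negLog, if_pos rfl, EReal.top_add_of_ne_bot (negLog_ne_bot a)]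
    simp [negLog]
  rw [negLog, negLog, negLog, if_neg ha, if_neg hb, if_neg (mul_ne_zero ha hb), ← EReal.coe_add,
    Real.log_mul ha hb]
  congr 1
  ring

theorem negLog_prod {ι : Type*} (s : Finset ι) (f : ι → ℝ) :
    negLog (∏ i ∈ s, f i) = ∑ i ∈ s, negLog (f i) := by
  classical
  induction s using Finset.induction_on with
  | empty => simp [negLog]
  | insert a s ha ih => rw [Finset.prod_insert ha, Finset.sum_insert ha, negLog_mul, ih]

theorem negLog_rpow {a : ℝ} (ha : 0 ≤ a) {c : ℝ} (hc : 0 ≤ c) :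
    negLog (a ^ c) = (c : EReal) * negLog a := by
  -- For `c = 0` the conventions `0 ^ 0 = 1` and `0 * ⊤ = 0` agree, which is what lets the case `μ =
  -- 0` go through uniformly.
  rcases hc.eq_or_lt with rfl | hc
  · simp [negLog]
  rcases ha.eq_or_lt with rfl | ha
  · rw [Real.zero_rpow hc.ne', negLog, if_pos rfl, EReal.coe_mul_top_of_pos hc]
  · rw [negLog, negLog, if_neg ha.ne', if_neg (Real.rpow_pos_of_pos ha c).ne', Real.log_rpow ha,
      ← EReal.coe_mul]
    congr 1
    ring

theorem negLog_le_coe_iff {a : ℝ} (ha : 0 ≤ a) (r : ℝ) :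
    negLog a ≤ (r : EReal) ↔ Real.exp (-r) ≤ a := by
  rcases ha.eq_or_lt with rfl | ha
  · simp [negLog, Real.exp_pos]
  · rw [negLog, if_neg ha.ne', EReal.coe_le_coe_iff, ← Real.le_log_iff_exp_le ha]
    constructor <;> intro h <;> linarith

theorem negLog_exp (r : ℝ) : negLog (Real.exp r) = ((-r : ℝ) : EReal) := by
  rw [negLog, if_neg (Real.exp_pos r).ne', Real.log_exp]

theorem logInv_eq_negLog (x : ℝ) : logInv x = negLog |x| := by
  unfold logInv negLog
  by_cases hx : x = 0
  · simp [hx]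
  · simp [hx]

/-- The exponential `|x|^{2c} e^{-x²}` of minus the potential. -/
def siteWeight (c x : ℝ) : ℝ := Real.exp (-x ^ 2) * |x| ^ (2 * c)

theorem siteWeight_nonneg (c x : ℝ) : 0 ≤ siteWeight c x := by
  unfold siteWeight; positivity

theorem potential_eq_negLog {c : ℝ} (hc : 0 ≤ c) (x : ℝ) :
    potential c x = negLog (siteWeight c x) := by
  rw [potential, siteWeight, negLog_mul, negLog_exp, negLog_rpow (abs_nonneg x) (by positivity),
    logInv_eq_negLog, neg_neg]

/-- The exponential of `-K`. -/
def gibbs (β α : ℝ) (n : ℕ) (x : Fin n → ℝ) : ℝ :=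
  (∏ p ∈ (Finset.univ : Finset (Fin n)).offDiag, |x p.1 - x p.2|) ^ (β / 2) *
    (∏ i, siteWeight α (x i)) ^ ((n : ℝ) - 1)

theorem gibbs_nonneg (β α : ℝ) (n : ℕ) (x : Fin n → ℝ) : 0 ≤ gibbs β α n x := by
  have := Finset.prod_nonneg fun i (_ : i ∈ Finset.univ) => siteWeight_nonneg α (x i)
  unfold gibbs
  positivity

theorem K_eq_negLog {β μ : ℝ} (hβ : 0 < β) (hμ : 0 ≤ μ) {n : ℕ} (hn : 1 ≤ n) (x : Fin n → ℝ) :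
    K β μ n x = negLog (gibbs β (μ / n) n x) := by
  have hn' : (0 : ℝ) ≤ (n : ℝ) - 1 := by
    have : (1 : ℝ) ≤ n := by exact_mod_cast hn
    linarith
  rw [gibbs, negLog_mul, negLog_rpow (Finset.prod_nonneg fun _ _ => abs_nonneg _) (by positivity),
    negLog_rpow (Finset.prod_nonneg fun _ _ => siteWeight_nonneg _ _) hn', negLog_prod, negLog_prod,
    K]
  simp only [logInv_eq_negLog, potential_eq_negLog (show 0 ≤ μ / n by positivity)]

/-- From here on, `EReal` no longer intervenes on the `K` side: a superlevel set of a continuous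
real function is closed and measurable at once. -/
theorem sublevel_eq {β c μ : ℝ} (hβ : 0 < β) (hμ : 0 ≤ μ) {n : ℕ} (hn : 1 ≤ n) {e : ℝ}
    (he : minEnergy β c = (e : EReal)) (ε : ℝ) :
    sublevel β c μ ε n =
      {x | Real.exp (-((e + ε) * (n : ℝ) ^ 2)) ≤ gibbs β (μ / n) n x} := by
  ext x
  rw [sublevel, Set.mem_ofPred_eq, Set.mem_ofPred_eq, K_eq_negLog hβ hμ hn, he, ← EReal.coe_add,
    ← EReal.coe_mul, negLog_le_coe_iff (gibbs_nonneg _ _ _ _)]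

theorem continuous_siteWeight {c : ℝ} (hc : 0 ≤ c) : Continuous (siteWeight c) := by
  unfold siteWeight
  exact (by fun_prop : Continuous fun x : ℝ => Real.exp (-x ^ 2)).mul
    (continuous_abs.rpow_const fun _ => Or.inr (by positivity))

theorem continuous_gibbs {β α : ℝ} (hβ : 0 < β) (hα : 0 ≤ α) {n : ℕ} (hn : 1 ≤ n) :
    Continuous (gibbs β α n) := by
  have hn' : (0 : ℝ) ≤ (n : ℝ) - 1 := by
    have : (1 : ℝ) ≤ n := by exact_mod_cast hn
    linarith
  have h := continuous_siteWeight hα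
  unfold gibbs
  refine (Continuous.rpow_const ?_ fun _ => Or.inr (by positivity)).mul
    (Continuous.rpow_const ?_ fun _ => Or.inr hn')
  · fun_prop
  · fun_prop

theorem prod_offDiag_eq {n : ℕ} (f : Fin n → Fin n → ℝ) :
    ∏ p ∈ (Finset.univ : Finset (Fin n)).offDiag, f p.1 p.2
      = ∏ i, ∏ j ∈ ({i}ᶜ : Finset (Fin n)), f i j := by
  rw [Finset.prod_sigma']
  refine Finset.prod_bij' (fun p _ => ⟨p.1, p.2⟩) (fun p _ => (p.1, p.2)) ?_ ?_ ?_ ?_ ?_ <;>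
    simp +contextual [eq_comm]

theorem prod_pairs_rpow {β : ℝ} (hβ : 0 < β) {n : ℕ} (x : Fin n → ℝ) :
    (∏ p ∈ (Finset.univ : Finset (Fin n)).offDiag, |x p.1 - x p.2|) ^ (β / 2)
      = ∏ i, ∏ j ∈ Finset.Ioi i, |x i - x j| ^ β := by
  rw [← Real.finsetProd_rpow _ _ fun _ _ => abs_nonneg _,
    prod_offDiag_eq fun i j => |x i - x j| ^ (β / 2)]
  rw [← Finset.prod_prod_Ioi_mul_eq_prod_prod_off_diag fun j i => |x i - x j| ^ (β / 2)]
  refine Finset.prod_congr rfl fun i _ => Finset.prod_congr rfl fun j _ => ?_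
  rw [abs_sub_comm (x j) (x i), ← Real.rpow_add_of_nonneg (abs_nonneg _) (by positivity)
    (by positivity), add_halves]

/-- The density has `n` copies of the site weight and `gibbs` only `n - 1`; the spare copy is what
makes a pointwise bound on `gibbs` integrable. -/
theorem weight_eq {β μ : ℝ} (hβ : 0 < β) {n : ℕ} (hn : 1 ≤ n) (x : Fin n → ℝ) :
    weight β μ n x = gibbs β (μ / n) n x * ∏ i, siteWeight (μ / n) (x i) := by
  have hn0 : (1 : ℝ) ≤ n := by exact_mod_cast hn
  have hS : 0 ≤ ∏ i, siteWeight (μ / n) (x i) :=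
    Finset.prod_nonneg fun _ _ => siteWeight_nonneg _ _
  have h1 : Real.exp (-(n : ℝ) * ∑ i, x i ^ 2) * (∏ i, |x i| ^ (2 * μ))
      = (∏ i, siteWeight (μ / n) (x i)) ^ (n : ℝ) := by
    rw [← Real.finsetProd_rpow _ _ fun _ _ => siteWeight_nonneg _ _, Finset.mul_sum, Real.exp_sum,
      ← Finset.prod_mul_distrib]
    refine Finset.prod_congr rfl fun i _ => ?_
    rw [siteWeight, Real.mul_rpow (Real.exp_pos _).le (by positivity), ← Real.exp_mul,
      ← Real.rpow_mul (abs_nonneg _)]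
    congr 2
    · ring
    · field_simp
  have h2 : (∏ i, siteWeight (μ / n) (x i)) ^ (n : ℝ)
      = (∏ i, siteWeight (μ / n) (x i)) ^ ((n : ℝ) - 1) * ∏ i, siteWeight (μ / n) (x i) := by
    conv_rhs => rw [← Real.rpow_one (∏ i, siteWeight (μ / n) (x i)), ← Real.rpow_mul hS, one_mul]
    rw [← Real.rpow_add_of_nonneg hS (by linarith) zero_le_one]
    congr 1
    ring
  rw [weight, h1, h2, gibbs, prod_pairs_rpow hβ]
  ring

/-! ### Gaussian decay and compactness of the sublevel sets. -/

/-- Combine `log (1 + |x|) ≤ |x|` with `m |x| ≤ m² / 2 + x² / 2`. -/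
theorem one_add_abs_rpow_mul_exp_le {m : ℝ} (hm : 0 ≤ m) (x : ℝ) :
    (1 + |x|) ^ m * Real.exp (-x ^ 2) ≤ Real.exp (m ^ 2 / 2 - x ^ 2 / 2) := by
  have h0 : 0 < 1 + |x| := by positivity
  rw [Real.rpow_def_of_pos h0, ← Real.exp_add, Real.exp_le_exp]
  have h1 : Real.log (1 + |x|) ≤ |x| := by
    have := Real.log_le_sub_one_of_pos h0
    linarith
  have h2 := mul_le_mul_of_nonneg_right h1 hm
  nlinarith [sq_nonneg (|x| - m), sq_abs x]

theorem siteWeight_mul_rpow_le {m α : ℝ} (hm : 0 ≤ m) (hα : 0 ≤ α) (x : ℝ) :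
    siteWeight α x * (1 + |x|) ^ m ≤ Real.exp ((m + 2 * α) ^ 2 / 2 - x ^ 2 / 2) := by
  refine le_trans ?_ (one_add_abs_rpow_mul_exp_le (by positivity) x)
  have h0 : 0 < 1 + |x| := by positivity
  have h : |x| ^ (2 * α) ≤ (1 + |x|) ^ (2 * α) :=
    Real.rpow_le_rpow (abs_nonneg x) (by linarith [abs_nonneg x]) (by positivity)
  rw [siteWeight, Real.rpow_add h0]
  calc _ = Real.exp (-x ^ 2) * (1 + |x|) ^ m * |x| ^ (2 * α) := by ring
    _ ≤ Real.exp (-x ^ 2) * (1 + |x|) ^ m * (1 + |x|) ^ (2 * α) := by gcongr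
    _ = _ := by ring

theorem siteWeight_le {α A : ℝ} (hα : 0 ≤ α) (hA : α ≤ A) (x : ℝ) :
    siteWeight α x ≤ Real.exp (2 * A ^ 2) * Real.exp (-(1 / 2) * x ^ 2) := by
  have h := siteWeight_mul_rpow_le le_rfl hα x
  rw [Real.rpow_zero, mul_one] at h
  refine h.trans ?_
  rw [← Real.exp_add, Real.exp_le_exp]
  nlinarith

theorem prod_pairs_le {n : ℕ} (hn : 1 ≤ n) (x : Fin n → ℝ) :
    ∏ p ∈ (Finset.univ : Finset (Fin n)).offDiag, |x p.1 - x p.2|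
      ≤ (∏ i, (1 + |x i|) ^ (2 : ℝ)) ^ ((n : ℝ) - 1) := by
  have hcard : ∀ i : Fin n, (({i}ᶜ : Finset (Fin n))).card = n - 1 := fun i => by
    rw [Finset.card_compl, Fintype.card_fin, Finset.card_singleton]
  have h1 : ∏ p ∈ (Finset.univ : Finset (Fin n)).offDiag, |x p.1 - x p.2|
      ≤ ∏ p ∈ (Finset.univ : Finset (Fin n)).offDiag, (1 + |x p.1|) * (1 + |x p.2|) := by
    refine Finset.prod_le_prod (fun _ _ => abs_nonneg _) fun p _ => ?_
    have := abs_sub (x p.1) (x p.2)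
    nlinarith [abs_nonneg (x p.1), abs_nonneg (x p.2), mul_nonneg (abs_nonneg (x p.1))
      (abs_nonneg (x p.2))]
  have h2 : ∏ p ∈ (Finset.univ : Finset (Fin n)).offDiag, (1 + |x p.1|)
      = ∏ i, (1 + |x i|) ^ (n - 1) := by
    rw [prod_offDiag_eq fun i _ => 1 + |x i|]
    simp only [Finset.prod_const, hcard]
  have h3 : ∏ p ∈ (Finset.univ : Finset (Fin n)).offDiag, (1 + |x p.2|)
      = ∏ p ∈ (Finset.univ : Finset (Fin n)).offDiag, (1 + |x p.1|) :=
    Finset.prod_nbij' Prod.swap Prod.swap (by simp [eq_comm]) (by simp [eq_comm]) (by simp)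
      (by simp) (by simp)
  refine h1.trans (le_of_eq ?_)
  rw [Finset.prod_mul_distrib, h3, h2, ← Nat.cast_one, ← Nat.cast_sub hn, Real.rpow_natCast,
    ← Finset.prod_mul_distrib, ← Finset.prod_pow]
  refine Finset.prod_congr rfl fun i _ => ?_
  rw [Real.rpow_two, ← mul_pow, sq]

/-- By `|s - t| ≤ (1 + |s|)(1 + |t|)`, and since each index lies in `2 (n - 1)` ordered pairs, the
interaction costs each coordinate `(1 + |x i|) ^ (β (n - 1))`. The `n - 1` copies of its site weight
absorb this. -/
theorem gibbs_le {β α : ℝ} (hβ : 0 < β) (hα : 0 ≤ α) {n : ℕ} (hn : 1 ≤ n) (x : Fin n → ℝ) :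
    gibbs β α n x
      ≤ Real.exp (((n : ℝ) - 1) * (n * ((β + 2 * α) ^ 2 / 2) - (∑ i, x i ^ 2) / 2)) := by
  have hn' : (0 : ℝ) ≤ (n : ℝ) - 1 := by
    have : (1 : ℝ) ≤ n := by exact_mod_cast hn
    linarith
  have hS : 0 ≤ ∏ i, siteWeight α (x i) := Finset.prod_nonneg fun _ _ => siteWeight_nonneg _ _
  have hP : 0 ≤ ∏ i, (1 + |x i|) ^ (2 : ℝ) := Finset.prod_nonneg fun _ _ => by positivity
  have hP' : 0 ≤ ∏ i, (1 + |x i|) ^ β := Finset.prod_nonneg fun _ _ => by positivity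
  have h1 : (∏ p ∈ (Finset.univ : Finset (Fin n)).offDiag, |x p.1 - x p.2|) ^ (β / 2)
      ≤ (∏ i, (1 + |x i|) ^ β) ^ ((n : ℝ) - 1) := by
    refine (Real.rpow_le_rpow (Finset.prod_nonneg fun _ _ => abs_nonneg _) (prod_pairs_le hn x)
      (by positivity)).trans (le_of_eq ?_)
    rw [← Real.rpow_mul hP, mul_comm, Real.rpow_mul hP, ← Real.finsetProd_rpow _ _ fun _ _ => by
      positivity]
    congr 1
    refine Finset.prod_congr rfl fun i _ => ?_
    rw [← Real.rpow_mul (by positivity)]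
    congr 1
    ring
  calc gibbs β α n x
      ≤ (∏ i, (1 + |x i|) ^ β) ^ ((n : ℝ) - 1) * (∏ i, siteWeight α (x i)) ^ ((n : ℝ) - 1) := by
        unfold gibbs
        gcongr
    _ = (∏ i, siteWeight α (x i) * (1 + |x i|) ^ β) ^ ((n : ℝ) - 1) := by
        rw [Finset.prod_mul_distrib, Real.mul_rpow hS hP', mul_comm]
    _ ≤ (∏ i, Real.exp ((β + 2 * α) ^ 2 / 2 - x i ^ 2 / 2)) ^ ((n : ℝ) - 1) := by
        refine Real.rpow_le_rpow (Finset.prod_nonneg fun i _ => ?_)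
          (Finset.prod_le_prod (fun i _ => ?_) fun i _ => siteWeight_mul_rpow_le hβ.le hα (x i)) hn'
        all_goals exact mul_nonneg (siteWeight_nonneg _ _) (by positivity)
    _ = _ := by
        rw [← Real.exp_sum, ← Real.exp_mul, Finset.sum_sub_distrib, Finset.sum_const,
          Finset.card_univ, Fintype.card_fin, nsmul_eq_mul, Finset.sum_div, mul_comm]

theorem isClosed_sublevel {β α : ℝ} (hβ : 0 < β) (hα : 0 ≤ α) {n : ℕ} (hn : 1 ≤ n) (r : ℝ) :
    IsClosed {x | Real.exp (-r) ≤ gibbs β α n x} :=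
  isClosed_le continuous_const (continuous_gibbs hβ hα hn)

theorem isCompact_sublevel {β α : ℝ} (hβ : 0 < β) (hα : 0 ≤ α) {n : ℕ} (hn : 2 ≤ n) (r : ℝ) :
    IsCompact {x | Real.exp (-r) ≤ gibbs β α n x} := by
  have hn1 : 1 ≤ n := by omega
  have hn' : (1 : ℝ) ≤ (n : ℝ) - 1 := by
    have : (2 : ℝ) ≤ n := by exact_mod_cast hn
    linarith
  set B : ℝ := n * ((β + 2 * α) ^ 2 / 2) with hB
  have hB0 : 0 ≤ B := by positivity
  refine Metric.isCompact_of_isClosed_isBounded (isClosed_sublevel hβ hα hn1 r) ?_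
  -- A bound `R` on the sum of squares bounds each coordinate by `1 + R`, as `|t| ≤ 1 + t²`. The
  -- bound on the sum needs `n - 1 ≥ 1`: at `n = 1` the estimate `gibbs_le` has no decay.
  refine (Metric.isBounded_closedBall (x := (0 : Fin n → ℝ))
    (r := 1 + 2 * (|r| + B))).subset fun x hx => ?_
  have h := Real.exp_le_exp.1 (le_trans hx (gibbs_le hβ hα hn1 x))
  have h2 : ∑ i, x i ^ 2 ≤ 2 * (|r| + B) := by
    by_contra! hlt
    have h3 : B - (∑ i, x i ^ 2) / 2 < -|r| := by linarith
    nlinarith [neg_abs_le r, le_abs_self r, abs_nonneg r]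
  rw [mem_closedBall_zero_iff, pi_norm_le_iff_of_nonneg (by positivity)]
  intro i
  have h4 : x i ^ 2 ≤ ∑ i, x i ^ 2 :=
    Finset.single_le_sum (fun j _ => sq_nonneg (x j)) (Finset.mem_univ i)
  rw [Real.norm_eq_abs]
  nlinarith [sq_abs (x i), abs_nonneg (x i), abs_nonneg r]

/-! ### Upper bound for the unnormalized mass of a set. -/

/-- The Gaussian integral that bounds the total site weight. -/
def siteMass (A : ℝ) : ℝ := Real.exp (2 * A ^ 2) * ∫ x : ℝ, Real.exp (-(1 / 2) * x ^ 2)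

theorem siteMass_pos (A : ℝ) : 0 < siteMass A := by
  unfold siteMass
  rw [integral_gaussian]
  positivity

theorem lintegral_prod_siteWeight_le {α A : ℝ} (hα : 0 ≤ α) (hA : α ≤ A) (n : ℕ) :
    ∫⁻ x : Fin n → ℝ, ENNReal.ofReal (∏ i, siteWeight α (x i)) ≤ ENNReal.ofReal (siteMass A ^ n) := by
  set g : ℝ → ℝ := fun x => Real.exp (2 * A ^ 2) * Real.exp (-(1 / 2) * x ^ 2) with hg
  have hint : Integrable g := (integrable_exp_neg_mul_sq (by norm_num)).const_mul _
  have hint' : Integrable fun x : Fin n → ℝ => ∏ i, g (x i) :=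
    Integrable.fintype_prod fun _ => hint
  have heq : siteMass A ^ n = ∫ x : Fin n → ℝ, ∏ i, g (x i) := by
    rw [integral_fintype_prod_volume_eq_pow, Fintype.card_fin, hg, integral_const_mul, siteMass]
  rw [heq, ofReal_integral_eq_lintegral_ofReal hint' (ae_of_all _ fun x =>
    Finset.prod_nonneg fun i _ => by positivity)]
  refine lintegral_mono fun x => ENNReal.ofReal_le_ofReal ?_
  exact Finset.prod_le_prod (fun i _ => siteWeight_nonneg _ _) fun i _ => siteWeight_le hα hA _

/-- Serves both for the complement of the sublevel set and, with `s` the whole space, for the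
finiteness of `Z_n`. The parameter `A` makes the constant uniform in `n` when `μ / n` stays bounded.
-/
theorem setLIntegral_weight_le {β μ A : ℝ} (hβ : 0 < β) (hμ : 0 ≤ μ) {n : ℕ} (hn : 1 ≤ n)
    (hA : μ / n ≤ A) {s : Set (Fin n → ℝ)} (hs : MeasurableSet s) {r : ℝ} (hr : 0 ≤ r)
    (h : ∀ x ∈ s, gibbs β (μ / n) n x ≤ r) :
    ∫⁻ x in s, ENNReal.ofReal (weight β μ n x) ≤ ENNReal.ofReal (r * siteMass A ^ n) := by
  have hα : 0 ≤ μ / n := by positivity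
  have h1 : ∀ x ∈ s, ENNReal.ofReal (weight β μ n x)
      ≤ ENNReal.ofReal r * ENNReal.ofReal (∏ i, siteWeight (μ / n) (x i)) := fun x hx => by
    rw [← ENNReal.ofReal_mul hr, weight_eq hβ hn]
    exact ENNReal.ofReal_le_ofReal (mul_le_mul_of_nonneg_right (h x hx)
      (Finset.prod_nonneg fun i _ => siteWeight_nonneg _ _))
  refine (setLIntegral_mono' hs h1).trans ((setLIntegral_le_lintegral _ _).trans ?_)
  rw [lintegral_const_mul' _ _ ENNReal.ofReal_ne_top, ENNReal.ofReal_mul hr]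
  exact mul_le_mul_right (lintegral_prod_siteWeight_le hα hA n) _

theorem partitionFunction_ne_top {β μ : ℝ} (hβ : 0 < β) (hμ : 0 ≤ μ) {n : ℕ} (hn : 1 ≤ n) :
    partitionFunction β μ n ≠ ⊤ := by
  have hα : 0 ≤ μ / n := by positivity
  have hn' : (0 : ℝ) ≤ (n : ℝ) - 1 := by
    have : (1 : ℝ) ≤ n := by exact_mod_cast hn
    linarith
  have h := setLIntegral_weight_le (A := μ / n) hβ hμ hn le_rfl MeasurableSet.univ
    (Real.exp_pos (((n : ℝ) - 1) * (n * ((β + 2 * (μ / n)) ^ 2 / 2)))).le fun x _ =>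
      (gibbs_le hβ hα hn x).trans (Real.exp_le_exp.2 (by
        have : 0 ≤ ∑ i, x i ^ 2 := Finset.sum_nonneg fun i _ => sq_nonneg _
        gcongr
        linarith))
  rw [Measure.restrict_univ] at h
  exact ne_top_of_le_ne_top ENNReal.ofReal_ne_top h

/-! ### Measures of bounded density and the lower bound for the partition function. -/

/-- The positive part of `log (1 / |x|)`. -/
def logSing (x : ℝ) : ℝ := max 0 (-Real.log x)

theorem logSing_nonneg (x : ℝ) : 0 ≤ logSing x := le_max_left _ _

theorem neg_log_le_logSing (x : ℝ) : -Real.log x ≤ logSing x := le_max_right _ _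

theorem measurable_logSing : Measurable logSing := by
  unfold logSing
  fun_prop

theorem measurable_log_sub : Measurable fun p : ℝ × ℝ => Real.log (p.1 - p.2) :=
  Real.measurable_log.comp (measurable_fst.sub measurable_snd)

theorem integral_comp_measurePreserving {X Y : Type*} [MeasurableSpace X] [MeasurableSpace Y]
    {ρ : Measure X} {σ : Measure Y} {f : X → Y} (hf : MeasurePreserving f ρ σ) {g : Y → ℝ}
    (hg : Measurable g) : ∫ x, g (f x) ∂ρ = ∫ y, g y ∂σ := by
  rw [← hf.map_eq, integral_map hf.aemeasurable hg.aestronglyMeasurable]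

theorem abs_log_le (x : ℝ) : |Real.log x| ≤ logSing x + |x| := by
  refine abs_le.2 ⟨?_, ?_⟩
  · linarith [neg_log_le_logSing x, abs_nonneg x]
  · rw [← Real.log_abs]
    linarith [Real.log_le_self (abs_nonneg x), logSing_nonneg x]

theorem integrable_logSing : Integrable logSing := by
  have h : IntervalIntegrable Real.log volume (-1) 1 := intervalIntegral.intervalIntegrable_log'
  rw [intervalIntegrable_iff_integrableOn_Icc_of_le (by norm_num)] at h
  have h2 : IntegrableOn logSing (Set.Icc (-1) 1) := (integrable_zero _ _ _).sup h.neg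
  refine (integrable_indicator_iff measurableSet_Icc).2 h2 |>.congr (ae_of_all _ fun x => ?_)
  by_cases hx : x ∈ Set.Icc (-1 : ℝ) 1
  · simp [hx]
  · rw [Set.indicator_of_notMem hx, logSing, max_eq_left]
    have h1 : 1 ≤ |x| := by
      by_contra! hlt
      exact hx (abs_le.1 hlt.le)
    rw [← Real.log_abs]
    linarith [Real.log_nonneg h1]

theorem ae_ne_zero_of_le {ν : Measure ℝ} {M : ℝ≥0∞} (hν : ν ≤ M • volume) : ∀ᵐ x ∂ν, x ≠ 0 := by
  have h : ∀ᵐ x ∂(M • volume : Measure ℝ), x ≠ 0 :=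
    Measure.ae_smul_measure (Measure.ae_ne volume 0) M
  exact (Measure.absolutelyContinuous_of_le hν) h

section BoundedDensity

variable {ν : Measure ℝ} [IsProbabilityMeasure ν] {M : ℝ≥0∞}

theorem lintegral_le_of_le_smul {X : Type*} [MeasurableSpace X] {ν ρ : Measure X}
    (hν : ν ≤ M • ρ) (f : X → ℝ≥0∞) : ∫⁻ x, f x ∂ν ≤ M * ∫⁻ x, f x ∂ρ := by
  refine (lintegral_mono' hν le_rfl).trans (le_of_eq ?_)
  rw [lintegral_smul_measure, smul_eq_mul]

theorem integrable_abs_of_sq (h2 : Integrable (fun x : ℝ => x ^ 2) ν) :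
    Integrable (fun x : ℝ => |x|) ν := by
  refine ((integrable_const (1 : ℝ)).add h2).mono' (by fun_prop) (ae_of_all _ fun x => ?_)
  simp only [Pi.add_apply, Real.norm_eq_abs, abs_abs]
  nlinarith [sq_nonneg (|x| - 1), sq_abs x, abs_nonneg x]

theorem integrable_log_of_le (hM : M ≠ ⊤) (hν : ν ≤ M • volume)
    (h2 : Integrable (fun x : ℝ => x ^ 2) ν) : Integrable Real.log ν := by
  have h : Integrable logSing ν := (integrable_logSing.smul_measure hM).mono_measure hν
  refine (h.add (integrable_abs_of_sq h2)).mono' (by fun_prop) (ae_of_all _ fun x => ?_)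
  exact abs_log_le x

/-- By translation invariance of Lebesgue measure, the inner integral is at most `M ∫ logSing`,
uniformly in the other variable. -/
theorem integrable_logSing_sub (hM : M ≠ ⊤) (hν : ν ≤ M • volume) :
    Integrable (fun p : ℝ × ℝ => logSing (p.1 - p.2)) (ν.prod ν) := by
  have hmeas : Measurable fun p : ℝ × ℝ => logSing (p.1 - p.2) :=
    measurable_logSing.comp (measurable_fst.sub measurable_snd)
  refine ⟨hmeas.aestronglyMeasurable, ?_⟩
  rw [HasFiniteIntegral, lintegral_prod_symm _ hmeas.enorm.aemeasurable]
  refine lt_of_le_of_lt (lintegral_mono (g := fun _ => M * ∫⁻ x, ‖logSing x‖ₑ) fun y => ?_) ?_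
  · refine (lintegral_le_of_le_smul hν _).trans (le_of_eq ?_)
    rw [lintegral_sub_right_eq_self (fun x => ‖logSing x‖ₑ) y]
  · rw [lintegral_const, measure_univ, mul_one]
    exact ENNReal.mul_lt_top hM.lt_top integrable_logSing.2

theorem integrable_log_sub (hM : M ≠ ⊤) (hν : ν ≤ M • volume)
    (h2 : Integrable (fun x : ℝ => x ^ 2) ν) :
    Integrable (fun p : ℝ × ℝ => Real.log (p.1 - p.2)) (ν.prod ν) := by
  have h1 := integrable_abs_of_sq h2
  refine ((integrable_logSing_sub hM hν).add ((h1.comp_fst ν).add (h1.comp_snd ν))).mono'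
    measurable_log_sub.aestronglyMeasurable (ae_of_all _ fun p => ?_)
  have := abs_log_le (p.1 - p.2)
  have := abs_sub p.1 p.2
  simp only [Pi.add_apply, Real.norm_eq_abs]
  linarith

theorem ae_ne_of_le (hν : ν ≤ M • volume) : ∀ᵐ p ∂(ν.prod ν), p.1 ≠ p.2 := by
  have hm : MeasurableSet {p : ℝ × ℝ | p.1 ≠ p.2} :=
    (measurableSet_eq_fun measurable_fst measurable_snd).compl
  rw [Measure.ae_prod_iff_ae_ae hm]
  refine ae_of_all _ fun x => ?_
  have h : ∀ᵐ y ∂(M • volume : Measure ℝ), y ≠ x :=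
    Measure.ae_smul_measure (Measure.ae_ne volume x) M
  filter_upwards [(Measure.absolutelyContinuous_of_le hν) h] with y hy using hy.symm

theorem map_eval_pair {n : ℕ} (ν : Measure ℝ) [IsProbabilityMeasure ν] {i j : Fin n} (hij : i ≠ j) :
    MeasurePreserving (fun x : Fin n → ℝ => (x i, x j)) (Measure.pi fun _ => ν) (ν.prod ν) := by
  refine ⟨by fun_prop, ?_⟩
  have h : ProbabilityTheory.IndepFun (fun x : Fin n → ℝ => x i) (fun x => x j)
      (Measure.pi fun _ => ν) :=
    (ProbabilityTheory.iIndepFun_pi (μ := fun _ : Fin n => ν) (X := fun _ => id)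
      fun _ => aemeasurable_id).indepFun hij
  have h' := (ProbabilityTheory.indepFun_iff_map_prod_eq_prod_map_map
    (measurable_pi_apply i).aemeasurable (measurable_pi_apply j).aemeasurable).1 h
  have hi : Measure.map (fun x : Fin n → ℝ => x i) (Measure.pi fun _ => ν) = ν :=
    (measurePreserving_eval (fun _ : Fin n => ν) i).map_eq
  have hj : Measure.map (fun x : Fin n → ℝ => x j) (Measure.pi fun _ => ν) = ν :=
    (measurePreserving_eval (fun _ : Fin n => ν) j).map_eq
  rw [h', hi, hj]

/-- Comparison on boxes is enough, since `OuterMeasure.pi` is the largest outer measure with the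
prescribed bounds on boxes. -/
theorem smul_pi_le (hM0 : M ≠ 0) (hM : M ≠ ⊤) (hν : ν ≤ M • volume) (n : ℕ) :
    (M ^ n)⁻¹ • (Measure.pi fun _ : Fin n => ν) ≤ volume := by
  have key : ((M ^ n)⁻¹ • (Measure.pi fun _ : Fin n => ν)).toOuterMeasure ≤
      OuterMeasure.pi fun _ : Fin n => (volume : Measure ℝ).toOuterMeasure := by
    rw [OuterMeasure.le_pi]
    intro s _
    change (M ^ n)⁻¹ * (Measure.pi fun _ : Fin n => ν) (Set.univ.pi s) ≤ ∏ i, volume (s i)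
    rw [Measure.pi_pi, ENNReal.inv_mul_le_iff (pow_ne_zero n hM0) (ENNReal.pow_ne_top hM)]
    calc ∏ i, ν (s i) ≤ ∏ i, M * volume (s i) := Finset.prod_le_prod' fun i _ => hν (s i)
      _ = _ := by simp [Finset.prod_mul_distrib]
  refine Measure.le_iff.2 fun s hs => ?_
  have hv : (volume : Measure (Fin n → ℝ)) s
      = (OuterMeasure.pi fun _ : Fin n => (volume : Measure ℝ).toOuterMeasure) s := by
    rw [volume_pi, Measure.pi, toMeasure_apply _ _ hs]
  rw [hv]
  exact key s

/-- The logarithmic energy `∬ log (1 / |s - t|) ν(ds) ν(dt)`. -/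
def logEnergy (ν : Measure ℝ) : ℝ := ∫ p, -Real.log (p.1 - p.2) ∂(ν.prod ν)

/-- The energy of a probability measure on the line, as an expression in real integrals. -/
def realEnergy (β c : ℝ) (ν : Measure ℝ) : ℝ :=
  β / 2 * logEnergy ν + ((∫ x, x ^ 2 ∂ν) + 2 * (c * ∫ x, -Real.log x ∂ν))

/-- Minus the logarithm of the unnormalized density. -/
def hamiltonian (β μ : ℝ) (n : ℕ) (x : Fin n → ℝ) : ℝ :=
  n * ∑ i, x i ^ 2 + 2 * μ * ∑ i, -Real.log (x i)
    + β / 2 * ∑ p ∈ (Finset.univ : Finset (Fin n)).offDiag, -Real.log (x p.1 - x p.2)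

/-- The convention `Real.log 0 = 0` breaks the identity where the weight vanishes; those
configurations are null for powers of a measure with bounded density. -/
theorem weight_eq_exp_neg_hamiltonian {β μ : ℝ} (hβ : 0 < β) {n : ℕ} {x : Fin n → ℝ}
    (h0 : ∀ i, x i ≠ 0) (h : ∀ i j, i ≠ j → x i ≠ x j) :
    weight β μ n x = Real.exp (-hamiltonian β μ n x) := by
  have h1 : ∏ i, |x i| ^ (2 * μ) = Real.exp (-(2 * μ * ∑ i, -Real.log (x i))) := by
    rw [Finset.mul_sum, ← Finset.sum_neg_distrib, Real.exp_sum]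
    refine Finset.prod_congr rfl fun i _ => ?_
    rw [Real.rpow_def_of_pos (abs_pos.2 (h0 i)), Real.log_abs]
    congr 1
    ring
  have h2 : ∏ i, ∏ j ∈ Finset.Ioi i, |x i - x j| ^ β = Real.exp (-(β / 2 *
      ∑ p ∈ (Finset.univ : Finset (Fin n)).offDiag, -Real.log (x p.1 - x p.2))) := by
    rw [← prod_pairs_rpow hβ, ← Real.finsetProd_rpow _ _ fun _ _ => abs_nonneg _, Finset.mul_sum,
      ← Finset.sum_neg_distrib, Real.exp_sum]
    refine Finset.prod_congr rfl fun p hp => ?_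
    have hne : p.1 ≠ p.2 := by simpa using hp
    rw [Real.rpow_def_of_pos (abs_pos.2 (sub_ne_zero.2 (h _ _ hne))), Real.log_abs]
    congr 1
    ring
  rw [weight, h1, h2, ← Real.exp_add, ← Real.exp_add, hamiltonian]
  congr 1
  ring

theorem integrable_hamiltonian (hM : M ≠ ⊤) (hν : ν ≤ M • volume)
    (h2 : Integrable (fun x : ℝ => x ^ 2) ν) (β μ : ℝ) (n : ℕ) :
    Integrable (hamiltonian β μ n) (Measure.pi fun _ => ν) ∧
      ∫ x, hamiltonian β μ n x ∂(Measure.pi fun _ => ν)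
        = n * (n * ∫ x, x ^ 2 ∂ν) + 2 * μ * (n * ∫ x, -Real.log x ∂ν)
          + β / 2 * (n * (n - 1) * logEnergy ν) := by
  have hev := fun i : Fin n => measurePreserving_eval (fun _ : Fin n => ν) i
  have a1 : ∀ i : Fin n, Integrable (fun x : Fin n → ℝ => x i ^ 2) (Measure.pi fun _ => ν) :=
    fun i => (hev i).integrable_comp_of_integrable h2
  have a2 : ∀ i : Fin n, Integrable (fun x : Fin n → ℝ => -Real.log (x i))
      (Measure.pi fun _ => ν) :=
    fun i => (hev i).integrable_comp_of_integrable (integrable_log_of_le hM hν h2).neg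
  have a3 : ∀ p ∈ (Finset.univ : Finset (Fin n)).offDiag,
      Integrable (fun x : Fin n → ℝ => -Real.log (x p.1 - x p.2)) (Measure.pi fun _ => ν) :=
    fun p hp => (map_eval_pair ν (i := p.1) (j := p.2)
      (by simpa using hp)).integrable_comp_of_integrable (integrable_log_sub hM hν h2).neg
  have b1 : ∀ i : Fin n, ∫ x : Fin n → ℝ, x i ^ 2 ∂(Measure.pi fun _ => ν) = ∫ x, x ^ 2 ∂ν :=
    fun i => integral_comp_measurePreserving (hev i) (g := fun x => x ^ 2) (by fun_prop)
  have b2 : ∀ i : Fin n, ∫ x : Fin n → ℝ, -Real.log (x i) ∂(Measure.pi fun _ => ν)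
      = ∫ x, -Real.log x ∂ν :=
    fun i => integral_comp_measurePreserving (hev i) (g := fun x => -Real.log x) (by fun_prop)
  have b3 : ∀ p ∈ (Finset.univ : Finset (Fin n)).offDiag,
      ∫ x : Fin n → ℝ, -Real.log (x p.1 - x p.2) ∂(Measure.pi fun _ => ν) = logEnergy ν :=
    fun p hp =>
      integral_comp_measurePreserving (map_eval_pair ν (i := p.1) (j := p.2) (by simpa using hp))
        measurable_log_sub.neg
  have c1 := integrable_finsetSum Finset.univ fun i _ => a1 i
  have c2 := integrable_finsetSum Finset.univ fun i _ => a2 i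
  have c3 := integrable_finsetSum _ a3
  have d1 := c1.const_mul (n : ℝ)
  have d2 := c2.const_mul (2 * μ)
  have d3 := c3.const_mul (β / 2)
  have d12 : Integrable (fun x : Fin n → ℝ => n * ∑ i, x i ^ 2 + 2 * μ * ∑ i, -Real.log (x i))
    (Measure.pi fun _ => ν) := d1.add d2
  refine ⟨d12.add d3, ?_⟩
  have hcard : (((Finset.univ : Finset (Fin n)).offDiag.card : ℕ) : ℝ) = n * (n - 1) := by
    rw [Finset.offDiag_card, Finset.card_univ, Fintype.card_fin, Nat.cast_sub (Nat.le_mul_self n)]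
    push_cast
    ring
  unfold hamiltonian
  rw [integral_add d12 d3, integral_add d1 d2, integral_const_mul, integral_const_mul,
    integral_const_mul, integral_finsetSum _ fun i _ => a1 i, integral_finsetSum _ fun i _ => a2 i,
    integral_finsetSum _ a3, Finset.sum_congr rfl b3]
  simp only [b1, b2, Finset.sum_const, Finset.card_univ, Fintype.card_fin, nsmul_eq_mul, hcard]

/-- Jensen's inequality for `exp`. If `exp (-h)` is not integrable the right side is infinite, so
only `h` has to be integrable. -/
theorem ofReal_exp_neg_integral_le {X : Type*} [MeasurableSpace X] {π : Measure X}
    [IsProbabilityMeasure π] {h : X → ℝ} (hh : Integrable h π) :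
    ENNReal.ofReal (Real.exp (-∫ x, h x ∂π)) ≤ ∫⁻ x, ENNReal.ofReal (Real.exp (-h x)) ∂π := by
  set m := ∫ x, h x ∂π with hm
  by_cases hi : Integrable (fun x => Real.exp (-h x)) π
  · rw [← ofReal_integral_eq_lintegral_ofReal hi (ae_of_all _ fun x => (Real.exp_pos _).le)]
    refine ENNReal.ofReal_le_ofReal ?_
    have := convexOn_exp.map_integral_le (μ := π) (f := fun x => -h x)
      Real.continuous_exp.continuousOn isClosed_univ (ae_of_all _ fun _ => Set.mem_univ _) hh.neg hi
    rwa [integral_neg] at this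
  · have : ∫⁻ x, ENNReal.ofReal (Real.exp (-h x)) ∂π = ⊤ := by
      by_contra hne
      refine hi ⟨(Real.continuous_exp.comp_aestronglyMeasurable hh.1.neg), ?_⟩
      rw [HasFiniteIntegral]
      convert lt_top_iff_ne_top.2 hne using 3 with x
      rw [Real.enorm_eq_ofReal (Real.exp_pos _).le]
    rw [this]
    exact le_top

/-- The crude density bound stands in for the entropy of `ν`: the factor `M ^ n` is negligible on
the scale `e^{n²}`. -/
theorem le_partitionFunction (hM0 : M ≠ 0) (hM : M ≠ ⊤) (hν : ν ≤ M • volume)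
    (h2 : Integrable (fun x : ℝ => x ^ 2) ν) {β : ℝ} (hβ : 0 < β) (μ : ℝ) (n : ℕ) :
    (M ^ n)⁻¹ * ENNReal.ofReal (Real.exp (-(n * (n * ∫ x, x ^ 2 ∂ν)
        + 2 * μ * (n * ∫ x, -Real.log x ∂ν) + β / 2 * (n * (n - 1) * logEnergy ν))))
      ≤ partitionFunction β μ n := by
  obtain ⟨hi, heq⟩ := integrable_hamiltonian hM hν h2 β μ n
  have h0 : ∀ᵐ x ∂(Measure.pi fun _ : Fin n => ν), ∀ i, x i ≠ 0 :=
    ae_all_iff.2 fun i => (measurePreserving_eval (fun _ : Fin n => ν) i).quasiMeasurePreserving.ae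
      (ae_ne_zero_of_le hν)
  have h1 : ∀ᵐ x ∂(Measure.pi fun _ : Fin n => ν), ∀ i j, i ≠ j → x i ≠ x j := by
    refine ae_all_iff.2 fun i => ae_all_iff.2 fun j => ?_
    by_cases hij : i = j
    · exact ae_of_all _ fun x h => absurd hij h
    · filter_upwards [(map_eval_pair ν hij).quasiMeasurePreserving.ae (ae_ne_of_le hν)] with x hx _
      exact hx
  calc _ ≤ (M ^ n)⁻¹ * ∫⁻ x, ENNReal.ofReal (Real.exp (-hamiltonian β μ n x))
          ∂(Measure.pi fun _ : Fin n => ν) := by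
        rw [← heq]
        exact mul_le_mul_right (ofReal_exp_neg_integral_le hi) _
    _ = (M ^ n)⁻¹ * ∫⁻ x, ENNReal.ofReal (weight β μ n x) ∂(Measure.pi fun _ : Fin n => ν) := by
        congr 1
        refine lintegral_congr_ae ?_
        filter_upwards [h0, h1] with x hx0 hx1
        rw [weight_eq_exp_neg_hamiltonian hβ hx0 hx1]
    _ = ∫⁻ x, ENNReal.ofReal (weight β μ n x)
          ∂((M ^ n)⁻¹ • (Measure.pi fun _ : Fin n => ν)) := by
        rw [lintegral_smul_measure, smul_eq_mul]
    _ ≤ partitionFunction β μ n := lintegral_mono' (smul_pi_le hM0 hM hν n) le_rfl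

end BoundedDensity

/-! ### Smoothing by a small uniform variable. -/

/-- The uniform distribution on `[0, 1]`. -/
def unif : Measure ℝ := volume.restrict (Set.Icc 0 1)

instance : IsProbabilityMeasure unif := ⟨by simp [unif]⟩

/-- The law of `X + δ U`, for `X` with law `ν` and an independent `U` uniform on `[0, 1]`. -/
def smooth (ν : Measure ℝ) (δ : ℝ) : Measure ℝ :=
  (ν.prod unif).map fun p => p.1 + δ * p.2

/-- A constant that dominates the effect of smoothing on the logarithmic kernel. -/
def smoothConst : ℝ := 2 * (Real.log 2 + ∫ x, logSing x) + 2

theorem smoothConst_nonneg : 0 ≤ smoothConst := by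
  have := integral_nonneg (μ := volume) (f := logSing) logSing_nonneg
  have := Real.log_nonneg one_le_two
  unfold smoothConst
  linarith

theorem ae_unif : ∀ᵐ u ∂unif, u ∈ Set.Icc (0 : ℝ) 1 := ae_restrict_mem measurableSet_Icc

theorem integrable_log_affine {δ : ℝ} (hδ : 0 < δ) (a : ℝ) :
    Integrable (fun u => Real.log (δ * u + a)) unif := by
  have h1 : Integrable (fun u => logSing (δ * u + a)) unif :=
    ((integrable_logSing.comp_add_right a).comp_mul_left' hδ.ne').restrict
  have h2 : Integrable (fun u : ℝ => |δ * u + a|) unif :=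
    (by fun_prop : Continuous fun u : ℝ => |δ * u + a|).integrableOn_Icc
  refine (h1.add h2).mono' (Real.measurable_log.comp
    (by fun_prop : Measurable fun u : ℝ => δ * u + a)).aestronglyMeasurable
    (ae_of_all _ fun u => ?_)
  exact abs_log_le _

theorem integral_logSing_add_le (b : ℝ) :
    ∫ u, logSing (u + b) ∂unif ≤ ∫ x, logSing x := by
  rw [← integral_add_right_eq_self logSing b]
  exact setIntegral_le_integral (integrable_logSing.comp_add_right b)
    (ae_of_all _ fun _ => logSing_nonneg _)

/-- The error is a constant times a quantity bounded by `1` that tends to `0` with `δ`, so dominated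
convergence will remove it under any finite measure. Here `v` is the distance of two points before
smoothing, and `w` the frozen noise of the second. -/
theorem integral_neg_log_le {δ v w : ℝ} (hδ : 0 < δ) (hv : v ≠ 0) (hw : w ∈ Set.Icc (0 : ℝ) 1) :
    ∫ u, -Real.log (v + δ * (u - w)) ∂unif ≤ -Real.log v + smoothConst * min 1 (δ / |v|) := by
  have hv' : 0 < |v| := abs_pos.2 hv
  have hL := integral_nonneg (μ := volume) (f := logSing) logSing_nonneg
  have hlog2 := Real.log_nonneg one_le_two
  have hint : Integrable (fun u => -Real.log (v + δ * (u - w))) unif := by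
    refine (integrable_log_affine hδ (v - δ * w)).neg.congr (ae_of_all _ fun u => ?_)
    simp only [Pi.neg_apply]
    congr 2
    ring
  -- Far case: the shift is at most `δ`, and `-log (1 - τ) ≤ 2 τ` for `τ = δ / |v| ≤ 1 / 2`, which
  -- is the summand `2` of `smoothConst`. Near case: rescaling by `δ` leaves `-log δ ≤ log 2 - log
  -- |v|` and an integral of `logSing`; the minimum is at least `1 / 2`, hence the factor `2` in
  -- `smoothConst`.
  rcases le_or_gt (2 * δ) |v| with h | h
  · have hτ : δ / |v| ≤ 1 / 2 := by rw [div_le_div_iff₀ hv' two_pos]; linarith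
    have hτ0 : 0 < δ / |v| := by positivity
    rw [min_eq_right (by linarith)]
    have hb : ∀ᵐ u ∂unif, -Real.log (v + δ * (u - w)) ≤ -Real.log v + 2 * (δ / |v|) := by
      filter_upwards [ae_unif] with u hu
      have huw : |u - w| ≤ 1 := abs_le.2 ⟨by linarith [hu.1, hw.2], by linarith [hu.2, hw.1]⟩
      have h1 : |v| * (1 - δ / |v|) ≤ |v + δ * (u - w)| := by
        have h2 : |v| * (1 - δ / |v|) = |v| - δ := by field_simp
        have h3 := abs_sub_abs_le_abs_sub v (-(δ * (u - w)))
        rw [abs_neg, abs_mul, abs_of_pos hδ, sub_neg_eq_add] at h3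
        nlinarith
      have h4 := Real.log_le_log (mul_pos hv' (by linarith)) h1
      rw [Real.log_mul hv'.ne' (by linarith), Real.log_abs, Real.log_abs] at h4
      have h5 := Real.one_sub_inv_le_log_of_pos (show 0 < 1 - δ / |v| by linarith)
      have h6 : (1 - δ / |v|)⁻¹ ≤ 1 + 2 * (δ / |v|) := by
        rw [inv_le_iff_one_le_mul₀ (by linarith)]
        nlinarith
      linarith
    refine (integral_mono_ae hint (integrable_const _) hb).trans ?_
    rw [integral_const, probReal_univ, one_smul]
    unfold smoothConst
    nlinarith
  · have hτ : 1 / 2 ≤ min 1 (δ / |v|) := by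
      refine le_min (by norm_num) ?_
      rw [div_le_div_iff₀ two_pos hv']
      linarith
    have hb : ∀ᵐ u ∂unif, -Real.log (v + δ * (u - w)) ≤ -Real.log δ + logSing (u + (v / δ - w)) := by
      have hne : ∀ᵐ u ∂unif, u ≠ -(v / δ - w) := ae_restrict_of_ae (Measure.ae_ne volume _)
      filter_upwards [hne] with u hu
      have h1 : v + δ * (u - w) = δ * (u + (v / δ - w)) := by field_simp; ring
      have h2 : u + (v / δ - w) ≠ 0 := fun h0 => hu (by linarith)
      rw [h1, Real.log_mul hδ.ne' h2]
      linarith [neg_log_le_logSing (u + (v / δ - w))]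
    have hint2 : Integrable (fun u => logSing (u + (v / δ - w))) unif :=
      (integrable_logSing.comp_add_right _).restrict
    refine (integral_mono_ae (g := fun u => -Real.log δ + logSing (u + (v / δ - w))) hint
      ((integrable_const _).add hint2) hb).trans ?_
    rw [integral_add (integrable_const _) hint2, integral_const, probReal_univ, one_smul]
    have h3 := integral_logSing_add_le (v / δ - w)
    have h4 : Real.log v ≤ Real.log 2 + Real.log δ := by
      rw [← Real.log_mul two_ne_zero hδ.ne', ← Real.log_abs]
      exact Real.log_le_log hv' h.le
    have h5 : Real.log 2 + ∫ x, logSing x ≤ smoothConst * min 1 (δ / |v|) := by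
      have := mul_le_mul_of_nonneg_left hτ smoothConst_nonneg
      unfold smoothConst at this ⊢
      linarith
    linarith

theorem measurable_smoothing (δ : ℝ) : Measurable fun p : ℝ × ℝ => p.1 + δ * p.2 := by fun_prop

theorem sq_smoothing_le {ν : Measure ℝ} {δ : ℝ} (hδ : 0 < δ) :
    ∀ᵐ p ∂(ν.prod unif), (p.1 + δ * p.2) ^ 2 ≤ p.1 ^ 2 + (2 * δ * |p.1| + δ ^ 2) := by
  filter_upwards [Measure.quasiMeasurePreserving_snd.ae ae_unif] with p hp
  have h1 : p.1 * p.2 ≤ |p.1| := by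
    have := mul_le_mul_of_nonneg_left hp.2 (abs_nonneg p.1)
    have := mul_le_mul_of_nonneg_right (le_abs_self p.1) hp.1
    linarith
  have h2 : p.2 ^ 2 ≤ 1 := by nlinarith [hp.1, hp.2]
  nlinarith [sq_nonneg δ]

section Smooth

variable {ν : Measure ℝ} [IsProbabilityMeasure ν] {δ : ℝ}

instance : IsProbabilityMeasure (smooth ν δ) :=
  Measure.isProbabilityMeasure_map (measurable_smoothing δ).aemeasurable

/-- Given the first variable, the sum is uniform on an interval of length `δ`. -/
theorem smooth_le (hδ : 0 < δ) : smooth ν δ ≤ ENNReal.ofReal δ⁻¹ • volume := by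
  refine Measure.le_iff.2 fun s hs => ?_
  rw [smooth, Measure.map_apply (measurable_smoothing δ) hs,
    Measure.prod_apply (measurable_smoothing δ hs)]
  have h : ∀ x, unif (Prod.mk x ⁻¹' ((fun p : ℝ × ℝ => p.1 + δ * p.2) ⁻¹' s))
      ≤ ENNReal.ofReal δ⁻¹ * volume s := fun x => by
    refine (Measure.restrict_apply_le _ _).trans (le_of_eq ?_)
    have : Prod.mk x ⁻¹' ((fun p : ℝ × ℝ => p.1 + δ * p.2) ⁻¹' s)
        = (fun u => δ * u) ⁻¹' ((fun y => x + y) ⁻¹' s) := rfl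
    rw [this, Real.volume_preimage_mul_left hδ.ne', measure_preimage_add, abs_of_pos (by positivity)]
  refine (lintegral_mono h).trans (le_of_eq ?_)
  rw [lintegral_const, measure_univ, mul_one, Measure.smul_apply, smul_eq_mul]

theorem integrable_sq_smooth (hδ : 0 < δ) (h2 : Integrable (fun x : ℝ => x ^ 2) ν) :
    Integrable (fun x : ℝ => x ^ 2) (smooth ν δ) ∧
      ∫ x, x ^ 2 ∂(smooth ν δ) ≤ (∫ x, x ^ 2 ∂ν) + (2 * δ * (∫ x, |x| ∂ν) + δ ^ 2) := by
  have h1 : Integrable (fun x : ℝ => 2 * δ * |x| + δ ^ 2) ν :=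
    ((integrable_abs_of_sq h2).const_mul _).add (integrable_const _)
  have hq : Integrable (fun x : ℝ => x ^ 2 + (2 * δ * |x| + δ ^ 2)) ν := h2.add h1
  have hi : Integrable (fun p : ℝ × ℝ => (p.1 + δ * p.2) ^ 2) (ν.prod unif) := by
    refine (hq.comp_fst unif).mono' (by fun_prop) ?_
    filter_upwards [sq_smoothing_le hδ] with p hp
    rwa [Real.norm_of_nonneg (sq_nonneg _)]
  refine ⟨(integrable_map_measure (by fun_prop) (by fun_prop)).2 hi, ?_⟩
  rw [smooth, integral_map (by fun_prop) (by fun_prop)]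
  refine (integral_mono_ae hi (hq.comp_fst unif) (sq_smoothing_le hδ)).trans (le_of_eq ?_)
  rw [integral_fun_fst (fun x : ℝ => x ^ 2 + (2 * δ * |x| + δ ^ 2)), probReal_univ, one_smul,
    integral_add h2 h1,
    integral_add ((integrable_abs_of_sq h2).const_mul _) (integrable_const _), integral_const_mul,
    integral_const, probReal_univ, one_smul]

theorem integrable_min_div {X : Type*} [MeasurableSpace X] {ρ : Measure X} [IsFiniteMeasure ρ]
    {f : X → ℝ} (hf : Measurable f) (hδ : 0 < δ) : Integrable (fun x => min 1 (δ / |f x|)) ρ := by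
  refine (integrable_const (1 : ℝ)).mono' (measurable_const.min
    (measurable_const.div (by fun_prop))).aestronglyMeasurable (ae_of_all _ fun x => ?_)
  rw [Real.norm_of_nonneg (le_min zero_le_one (by positivity))]
  exact min_le_left _ _

theorem integral_neg_log_add_min_div {X : Type*} [MeasurableSpace X] {ρ : Measure X}
    [IsFiniteMeasure ρ] {f : X → ℝ} (hf : Measurable f) (hδ : 0 < δ)
    (hlog : Integrable (fun x => Real.log (f x)) ρ) (C : ℝ) :
    Integrable (fun x => -Real.log (f x) + C * min 1 (δ / |f x|)) ρ ∧
      ∫ x, (-Real.log (f x) + C * min 1 (δ / |f x|)) ∂ρ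
        = (∫ x, -Real.log (f x) ∂ρ) + C * ∫ x, min 1 (δ / |f x|) ∂ρ := by
  have h1 : Integrable (fun x => -Real.log (f x)) ρ := hlog.neg
  have h2 := (integrable_min_div (ρ := ρ) hf hδ).const_mul C
  exact ⟨h1.add h2, by rw [integral_add h1 h2, integral_const_mul]⟩

theorem tendsto_integral_min_div {X : Type*} [MeasurableSpace X] {ρ : Measure X}
    [IsFiniteMeasure ρ] {f : X → ℝ} (hf : Measurable f) :
    Tendsto (fun k : ℕ => ∫ x, min 1 (1 / ((k : ℝ) + 1) / |f x|) ∂ρ) atTop (𝓝 0) := by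
  have h := tendsto_integral_of_dominated_convergence (μ := ρ) (fun _ => (1 : ℝ))
    (F := fun (k : ℕ) x => min 1 (1 / ((k : ℝ) + 1) / |f x|)) (f := fun _ => (0 : ℝ))
    (fun k => (integrable_min_div hf (by positivity)).1) (integrable_const _)
    (fun k => ae_of_all _ fun x => by
      rw [Real.norm_of_nonneg (le_min zero_le_one (by positivity))]
      exact min_le_left _ _)
    -- Where `f x = 0` the convention `a / 0 = 0` makes the integrand `0`, so no null set has to be
    -- removed.
    (ae_of_all _ fun x => by
      have h1 := (tendsto_one_div_add_atTop_nhds_zero_nat (𝕜 := ℝ)).div_const |f x|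
      have h2 := (tendsto_const_nhds (x := (1 : ℝ))).min h1
      simpa using h2)
  simpa using h

/-- Smoothing of one point against a frozen one. It yields the external field with `y = w = 0`, and
the interaction after integration over the second smoothed point. -/
theorem integral_smoothing_le {y w : ℝ} (hδ : 0 < δ) (hw : w ∈ Set.Icc (0 : ℝ) 1)
    (hlog : Integrable (fun x => Real.log (x - y)) ν) (hne : ∀ᵐ x ∂ν, x ≠ y)
    (hF : Integrable (fun p : ℝ × ℝ => -Real.log (p.1 + δ * p.2 - (y + δ * w))) (ν.prod unif)) :
    ∫ p, -Real.log (p.1 + δ * p.2 - (y + δ * w)) ∂(ν.prod unif)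
      ≤ ∫ x, (-Real.log (x - y) + smoothConst * min 1 (δ / |x - y|)) ∂ν := by
  rw [integral_prod _ hF]
  refine integral_mono_ae hF.integral_prod_left
    (hlog.neg.add ((integrable_min_div (by fun_prop) hδ).const_mul _)) ?_
  filter_upwards [hne] with x hx
  have h := integral_neg_log_le hδ (sub_ne_zero.2 hx) hw
  refine le_trans (le_of_eq ?_) h
  refine integral_congr_ae (ae_of_all _ fun u => ?_)
  simp only
  congr 2
  ring

theorem integral_neg_log_smooth_le (hδ : 0 < δ) (h2 : Integrable (fun x : ℝ => x ^ 2) ν)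
    (hlog : Integrable Real.log ν) (hne : ∀ᵐ x ∂ν, x ≠ 0) :
    ∫ x, -Real.log x ∂(smooth ν δ)
      ≤ (∫ x, -Real.log x ∂ν) + smoothConst * ∫ x, min 1 (δ / |x|) ∂ν := by
  have hi : Integrable (fun x => -Real.log x) (smooth ν δ) :=
    (integrable_log_of_le ENNReal.ofReal_ne_top (smooth_le hδ) (integrable_sq_smooth hδ h2).1).neg
  have hF := (integrable_map_measure (by fun_prop) (by fun_prop)).1 hi
  have h := integral_smoothing_le (ν := ν) (y := 0) (w := 0) hδ (by simp) (by simpa using hlog) hne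
    (by simpa [Function.comp_def] using hF.neg)
  rw [smooth, integral_map (by fun_prop) (by fun_prop)]
  simp only [mul_zero, add_zero, sub_zero] at h
  exact h.trans (integral_neg_log_add_min_div (f := fun x => x) measurable_id hδ hlog _).2.le

theorem logEnergy_smooth_le (hδ : 0 < δ) (h2 : Integrable (fun x : ℝ => x ^ 2) ν)
    (hlog : Integrable (fun p : ℝ × ℝ => Real.log (p.1 - p.2)) (ν.prod ν))
    (hne : ∀ᵐ p ∂(ν.prod ν), p.1 ≠ p.2) :
    logEnergy (smooth ν δ)
      ≤ logEnergy ν + smoothConst * ∫ p, min 1 (δ / |p.1 - p.2|) ∂(ν.prod ν) := by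
  have hmp : MeasurePreserving (fun p : ℝ × ℝ => p.1 + δ * p.2) (ν.prod unif) (smooth ν δ) :=
    ⟨measurable_smoothing δ, rfl⟩
  have hmp2 := hmp.prod hmp
  have hi : Integrable (fun p : ℝ × ℝ => -Real.log (p.1 - p.2)) ((smooth ν δ).prod (smooth ν δ)) :=
    (integrable_log_sub ENNReal.ofReal_ne_top (smooth_le hδ) (integrable_sq_smooth hδ h2).1).neg
  have hF : Integrable (fun z : (ℝ × ℝ) × (ℝ × ℝ) =>
      -Real.log (z.1.1 + δ * z.1.2 - (z.2.1 + δ * z.2.2))) ((ν.prod unif).prod (ν.prod unif)) :=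
    hmp2.integrable_comp_of_integrable hi
  have hGi := integral_neg_log_add_min_div (f := fun p : ℝ × ℝ => p.1 - p.2) (by fun_prop) hδ hlog
    smoothConst
  have hG := hGi.1
  have e1 : logEnergy (smooth ν δ) = ∫ q, ∫ p, -Real.log (p.1 + δ * p.2 - (q.1 + δ * q.2))
      ∂(ν.prod unif) ∂(ν.prod unif) := by
    rw [← integral_prod_symm (fun z : (ℝ × ℝ) × (ℝ × ℝ) =>
      -Real.log (z.1.1 + δ * z.1.2 - (z.2.1 + δ * z.2.2))) hF]
    exact (integral_comp_measurePreserving hmp2 measurable_log_sub.neg).symm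
  have hyne : ∀ᵐ y ∂ν, ∀ᵐ x ∂ν, x ≠ y := by
    have h := Measure.ae_ae_of_ae_prod hne
    filter_upwards [h] with y hy
    filter_upwards [hy] with x hx using hx.symm
  have hylog : ∀ᵐ y ∂ν, Integrable (fun x => Real.log (x - y)) ν := hlog.prod_left_ae
  have hG' : Integrable (fun y => ∫ x, (-Real.log (x - y) + smoothConst * min 1 (δ / |x - y|)) ∂ν) ν :=
    hG.integral_prod_right
  have e2 : ∫ y, ∫ x, (-Real.log (x - y) + smoothConst * min 1 (δ / |x - y|)) ∂ν ∂ν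
      = logEnergy ν + smoothConst * ∫ p, min 1 (δ / |p.1 - p.2|) ∂(ν.prod ν) := by
    rw [← integral_prod_symm (fun p : ℝ × ℝ =>
      -Real.log (p.1 - p.2) + smoothConst * min 1 (δ / |p.1 - p.2|)) hG]
    exact hGi.2
  rw [e1, ← e2]
  refine (integral_mono_ae hF.integral_prod_right (hG'.comp_fst unif) ?_).trans (le_of_eq ?_)
  · filter_upwards [hF.prod_left_ae, Measure.quasiMeasurePreserving_fst.ae hyne,
      Measure.quasiMeasurePreserving_fst.ae hylog,
      Measure.quasiMeasurePreserving_snd.ae ae_unif] with q h1 h2 h3 h4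
    exact integral_smoothing_le hδ h4 h3 h2 h1
  · rw [integral_fun_fst (fun y => ∫ x, (-Real.log (x - y) + smoothConst * min 1 (δ / |x - y|)) ∂ν),
      probReal_univ, one_smul]

theorem exists_realEnergy_smooth_lt {β c : ℝ} (hβ : 0 < β) (hc : 0 ≤ c)
    (h2 : Integrable (fun x : ℝ => x ^ 2) ν)
    (hlog : Integrable (fun p : ℝ × ℝ => Real.log (p.1 - p.2)) (ν.prod ν))
    (hne : ∀ᵐ p ∂(ν.prod ν), p.1 ≠ p.2) (hne0 : c = 0 ∨ ∀ᵐ x ∂ν, x ≠ 0)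
    (hlog0 : c = 0 ∨ Integrable Real.log ν) {a : ℝ} (ha : realEnergy β c ν < a) :
    ∃ δ : ℝ, 0 < δ ∧ realEnergy β c (smooth ν δ) < a := by
  -- `S` bounds the smoothed energy above and tends to the original energy along `δ = 1 / (k + 1)`.
  -- For `c = 0` the factor `c` removes the `log |x|` integrals, about which nothing is then known.
  set S : ℝ → ℝ := fun δ => β / 2 * (logEnergy ν + smoothConst *
      ∫ p, min 1 (δ / |p.1 - p.2|) ∂(ν.prod ν)) +
    (((∫ x, x ^ 2 ∂ν) + (2 * δ * (∫ x, |x| ∂ν) + δ ^ 2)) +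
      2 * (c * ((∫ x, -Real.log x ∂ν) + smoothConst * ∫ x, min 1 (δ / |x|) ∂ν))) with hS
  have hle : ∀ δ, 0 < δ → realEnergy β c (smooth ν δ) ≤ S δ := fun δ hδ => by
    have h3 := logEnergy_smooth_le hδ h2 hlog hne
    have h4 := (integrable_sq_smooth hδ h2).2
    have h5 : c * ∫ x, -Real.log x ∂(smooth ν δ)
        ≤ c * ((∫ x, -Real.log x ∂ν) + smoothConst * ∫ x, min 1 (δ / |x|) ∂ν) := by
      rcases hlog0 with rfl | hlog0
      · simp
      rcases hne0 with rfl | hne0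
      · simp
      exact mul_le_mul_of_nonneg_left (integral_neg_log_smooth_le hδ h2 hlog0 hne0) hc
    have h6 := mul_le_mul_of_nonneg_left h3 (show 0 ≤ β / 2 by positivity)
    rw [realEnergy, hS]
    linarith
  have ht : Tendsto (fun k : ℕ => S (1 / ((k : ℝ) + 1))) atTop (𝓝 (realEnergy β c ν)) := by
    have t0 := tendsto_one_div_add_atTop_nhds_zero_nat (𝕜 := ℝ)
    have t1 := tendsto_integral_min_div (ρ := ν.prod ν) (f := fun p => p.1 - p.2) (by fun_prop)
    have t2 := tendsto_integral_min_div (ρ := ν) (f := fun x => x) measurable_id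
    have := (((t1.const_mul smoothConst).const_add (logEnergy ν)).const_mul (β / 2)).add
      (((((t0.const_mul 2).mul_const (∫ x, |x| ∂ν)).add (t0.pow 2)).const_add
        (∫ x, x ^ 2 ∂ν)).add ((((t2.const_mul smoothConst).const_add
          (∫ x, -Real.log x ∂ν)).const_mul c).const_mul 2))
    simpa [realEnergy, hS] using this
  obtain ⟨k, hk⟩ := (ht.eventually_lt_const ha).exists
  exact ⟨1 / ((k : ℝ) + 1), by positivity, (hle _ (by positivity)).trans_lt hk⟩

end Smooth

/-! ### From extended-real integrals to convergent real ones. -/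

theorem measurable_negLog : Measurable negLog :=
  Measurable.ite (measurableSet_singleton 0) measurable_const
    (measurable_coe_real_ereal.comp Real.measurable_log.neg)

section ExtIntegral

variable {X : Type*} [MeasurableSpace X] {m : Measure X} {h b : X → ℝ}

theorem extIntegral_negLog_eq (hne : ∀ᵐ x ∂m, h x ≠ 0)
    (hi : Integrable (fun x => Real.log (h x)) m) :
    extIntegral m (fun x => negLog (h x)) = ((∫ x, -Real.log (h x) ∂m : ℝ) : EReal) := by
  have hi' : Integrable (fun x => -Real.log (h x)) m := hi.neg
  have e1 : ∫⁻ x, (negLog (h x)).toENNReal ∂m = ∫⁻ x, ENNReal.ofReal (-Real.log (h x)) ∂m := by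
    refine lintegral_congr_ae ?_
    filter_upwards [hne] with x hx
    rw [negLog, if_neg hx, EReal.real_coe_toENNReal]
  have e2 : ∫⁻ x, (-negLog (h x)).toENNReal ∂m
      = ∫⁻ x, ENNReal.ofReal (-(-Real.log (h x))) ∂m := by
    refine lintegral_congr_ae ?_
    filter_upwards [hne] with x hx
    rw [negLog, if_neg hx, ← EReal.coe_neg, EReal.real_coe_toENNReal]
  have f1 : ∫⁻ x, ENNReal.ofReal (-Real.log (h x)) ∂m ≠ ⊤ := hi'.lintegral_lt_top.ne
  have f2 : ∫⁻ x, ENNReal.ofReal (-(-Real.log (h x))) ∂m ≠ ⊤ := hi'.neg.lintegral_lt_top.ne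
  rw [extIntegral, e1, e2, integral_eq_lintegral_pos_part_sub_lintegral_neg_part hi', EReal.coe_sub,
    EReal.coe_ennreal_toReal f1, EReal.coe_ennreal_toReal f2]

theorem lintegral_neg_negLog_ne_top (hb : Integrable b m)
    (hle : ∀ x, h x ≠ 0 → Real.log (h x) ≤ b x) :
    ∫⁻ x, (-negLog (h x)).toENNReal ∂m ≠ ⊤ := by
  refine ne_top_of_le_ne_top hb.lintegral_lt_top.ne (lintegral_mono fun x => ?_)
  by_cases hx : h x = 0
  · simp [negLog, hx]
  · rw [negLog, if_neg hx, ← EReal.coe_neg, EReal.real_coe_toENNReal, neg_neg]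
    exact ENNReal.ofReal_le_ofReal (hle x hx)

theorem extIntegral_negLog_ne_bot (hb : Integrable b m)
    (hle : ∀ x, h x ≠ 0 → Real.log (h x) ≤ b x) :
    extIntegral m (fun x => negLog (h x)) ≠ ⊥ := by
  have hN := lintegral_neg_negLog_ne_top hb hle
  rw [extIntegral, sub_eq_add_neg, Ne, EReal.add_eq_bot_iff, EReal.neg_eq_bot_iff,
    EReal.coe_ennreal_eq_top_iff]
  simp [hN]

/-- The majorant `b` makes the negative part of `negLog ∘ h` integrable, so a value other than `⊤`
forces the positive part to be integrable too. -/
theorem of_extIntegral_negLog_ne_top (hm : Measurable h) (hb : Integrable b m)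
    (hle : ∀ x, h x ≠ 0 → Real.log (h x) ≤ b x)
    (ht : extIntegral m (fun x => negLog (h x)) ≠ ⊤) :
    (∀ᵐ x ∂m, h x ≠ 0) ∧ Integrable (fun x => Real.log (h x)) m := by
  have hN := lintegral_neg_negLog_ne_top hb hle
  have hP : ∫⁻ x, (negLog (h x)).toENNReal ∂m ≠ ⊤ := by
    intro hP
    refine ht ?_
    rw [extIntegral, hP, EReal.coe_ennreal_top, sub_eq_add_neg, EReal.top_add_of_ne_bot]
    rwa [Ne, EReal.neg_eq_bot_iff, EReal.coe_ennreal_eq_top_iff]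
  have hmeas : Measurable fun x => negLog (h x) := measurable_negLog.comp hm
  have hne : ∀ᵐ x ∂m, h x ≠ 0 := by
    filter_upwards [ae_lt_top hmeas.ereal_toENNReal hP] with x hx h0
    simp [negLog, h0] at hx
  refine ⟨hne, (Real.measurable_log.comp hm).aestronglyMeasurable, ?_⟩
  have hsum : ∫⁻ x, (negLog (h x)).toENNReal + (-negLog (h x)).toENNReal ∂m ≠ ⊤ := by
    rw [lintegral_add_left hmeas.ereal_toENNReal]
    exact ENNReal.add_ne_top.2 ⟨hP, hN⟩
  refine lt_of_le_of_lt (lintegral_mono_ae ?_) hsum.lt_top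
  filter_upwards [hne] with x hx
  rw [negLog, if_neg hx, ← EReal.coe_neg, EReal.real_coe_toENNReal, EReal.real_coe_toENNReal,
    neg_neg, Real.enorm_eq_ofReal_abs]
  rcases le_total 0 (Real.log (h x)) with h0 | h0
  · rw [abs_of_nonneg h0]
    exact le_add_self
  · rw [abs_of_nonpos h0]
    exact le_self_add

end ExtIntegral

theorem log_abs_sub_le (s t : ℝ) (hst : |s - t| ≠ 0) :
    Real.log |s - t| ≤ Real.log (1 + |s|) + Real.log (1 + |t|) := by
  rw [← Real.log_mul (by positivity) (by positivity)]
  refine Real.log_le_log (lt_of_le_of_ne (abs_nonneg _) hst.symm) ?_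
  have := abs_sub s t
  nlinarith [mul_nonneg (abs_nonneg s) (abs_nonneg t)]

theorem siteWeight_ne_zero_iff (c x : ℝ) :
    siteWeight c x ≠ 0 ↔ c = 0 ∨ x ≠ 0 := by
  have := Real.exp_ne_zero (-x ^ 2)
  simp only [siteWeight, ne_eq, mul_eq_zero, Real.rpow_eq_zero_iff_of_nonneg (abs_nonneg x),
    abs_eq_zero, this, OfNat.ofNat_ne_zero, false_or]
  tauto

theorem log_siteWeight {c : ℝ} (hc : 0 ≤ c) {x : ℝ} (hx : siteWeight c x ≠ 0) :
    Real.log (siteWeight c x) = -x ^ 2 + 2 * (c * Real.log x) := by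
  rcases (siteWeight_ne_zero_iff c x).1 hx with rfl | h
  · simp [siteWeight]
  · rw [siteWeight, Real.log_mul (Real.exp_ne_zero _) (by positivity), Real.log_exp,
      Real.log_rpow (abs_pos.2 h), Real.log_abs]
    ring

theorem log_siteWeight_le {m c : ℝ} (hm : 0 ≤ m) (hc : 0 ≤ c) {x : ℝ} (hx : siteWeight c x ≠ 0) :
    Real.log (siteWeight c x) + m * Real.log (1 + |x|) ≤ (m + 2 * c) ^ 2 / 2 - x ^ 2 / 2 := by
  have h0 : 0 < 1 + |x| := by positivity
  have hp : 0 < siteWeight c x := lt_of_le_of_ne (siteWeight_nonneg _ _) hx.symm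
  rw [← Real.log_rpow h0, ← Real.log_mul hx (by positivity),
    Real.log_le_iff_le_exp (by positivity)]
  exact siteWeight_mul_rpow_le hm hc x

section Energy

variable {β c : ℝ} {ν : Measure ℝ}

theorem energy_eq (hc : 0 ≤ c) (h : Integrable (fun t : ℝ => Real.log (1 + |t|)) ν) :
    energy β c ν = ((β / 2 : ℝ) : EReal) *
        extIntegral (ν.prod ν) (fun p : ℝ × ℝ => negLog |p.1 - p.2|)
      + extIntegral ν (fun x => negLog (siteWeight c x)) := by
  rw [energy, if_pos h]
  simp only [logInv_eq_negLog]
  congr 2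
  funext x
  exact potential_eq_negLog hc x

/-- The conditions under which the energy is given by convergent real integrals. -/
structure HasFiniteEnergy (c : ℝ) (ν : Measure ℝ) : Prop where
  sq : Integrable (fun x : ℝ => x ^ 2) ν
  log_sub : Integrable (fun p : ℝ × ℝ => Real.log (p.1 - p.2)) (ν.prod ν)
  ae_ne : ∀ᵐ p ∂(ν.prod ν), p.1 ≠ p.2
  ae_ne_zero : c = 0 ∨ ∀ᵐ x ∂ν, x ≠ 0
  log : c = 0 ∨ Integrable Real.log ν

theorem HasFiniteEnergy.ae_siteWeight_ne_zero (h : HasFiniteEnergy c ν) :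
    ∀ᵐ x ∂ν, siteWeight c x ≠ 0 := by
  rcases h.ae_ne_zero with h0 | h0
  · exact ae_of_all _ fun x => (siteWeight_ne_zero_iff c x).2 (Or.inl h0)
  · filter_upwards [h0] with x hx using (siteWeight_ne_zero_iff c x).2 (Or.inr hx)

variable [IsProbabilityMeasure ν]

theorem integrable_log_one_add (h2 : Integrable (fun x : ℝ => x ^ 2) ν) :
    Integrable (fun t : ℝ => Real.log (1 + |t|)) ν := by
  refine (integrable_abs_of_sq h2).mono' (Real.measurable_log.comp
    (by fun_prop : Measurable fun t : ℝ => 1 + |t|)).aestronglyMeasurable (ae_of_all _ fun t => ?_)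
  have h0 : (1 : ℝ) ≤ 1 + |t| := by linarith [abs_nonneg t]
  rw [Real.norm_of_nonneg (Real.log_nonneg h0)]
  linarith [Real.log_le_sub_one_of_pos (show 0 < 1 + |t| by positivity)]

theorem HasFiniteEnergy.integrable_log_siteWeight (hc : 0 ≤ c) (h : HasFiniteEnergy c ν) :
    Integrable (fun x => Real.log (siteWeight c x)) ν ∧
      ∫ x, -Real.log (siteWeight c x) ∂ν
        = (∫ x, x ^ 2 ∂ν) + 2 * (c * ∫ x, -Real.log x ∂ν) := by
  have h1 : Integrable (fun x => -(c * Real.log x)) ν := by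
    rcases h.log with h0 | h0
    · simp [h0]
    · exact (h0.const_mul c).neg
  have h2 : Integrable (fun x => x ^ 2 + 2 * -(c * Real.log x)) ν := h.sq.add (h1.const_mul 2)
  have he : (fun x => x ^ 2 + 2 * -(c * Real.log x))
      =ᵐ[ν] fun x => -Real.log (siteWeight c x) := by
    filter_upwards [h.ae_siteWeight_ne_zero] with x hx
    rw [log_siteWeight hc hx]
    ring
  refine ⟨by simpa using (h2.congr he).neg, ?_⟩
  rw [← integral_congr_ae he, integral_add h.sq (h1.const_mul 2), integral_const_mul]
  congr 2
  rw [← integral_const_mul]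
  exact integral_congr_ae (ae_of_all _ fun x => by ring)

theorem HasFiniteEnergy.energy_eq (hc : 0 ≤ c) (h : HasFiniteEnergy c ν) :
    energy β c ν = (realEnergy β c ν : EReal) := by
  have h1 := h.integrable_log_siteWeight hc
  have e1 : extIntegral (ν.prod ν) (fun p : ℝ × ℝ => negLog |p.1 - p.2|)
      = (logEnergy ν : EReal) := by
    rw [extIntegral_negLog_eq (by
      filter_upwards [h.ae_ne] with p hp using abs_ne_zero.2 (sub_ne_zero.2 hp))
      (by simpa using h.log_sub)]
    simp [logEnergy]
  rw [ChiralEnsemble.energy_eq hc (integrable_log_one_add h.sq), e1,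
    extIntegral_negLog_eq (h.ae_siteWeight_ne_zero) h1.1, h1.2, ← EReal.coe_mul,
    ← EReal.coe_add, realEnergy]

/-- Neither term of the energy is `⊥`, so a sum different from `⊤` leaves both terms finite. -/
theorem hasFiniteEnergy_of_energy_ne_top (hβ : 0 < β) (hc : 0 ≤ c) (h : energy β c ν ≠ ⊤) :
    HasFiniteEnergy c ν := by
  have h1 : Integrable (fun t : ℝ => Real.log (1 + |t|)) ν := by
    by_contra hn
    exact h (by rw [energy, if_neg hn])
  rw [energy_eq hc h1] at h
  have b1 : Integrable (fun p : ℝ × ℝ => Real.log (1 + |p.1|) + Real.log (1 + |p.2|))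
    (ν.prod ν) := (h1.comp_fst ν).add (h1.comp_snd ν)
  have l1 : ∀ p : ℝ × ℝ, |p.1 - p.2| ≠ 0 →
    Real.log |p.1 - p.2| ≤ Real.log (1 + |p.1|) + Real.log (1 + |p.2|) :=
    fun p hp => log_abs_sub_le _ _ hp
  have b2 : Integrable (fun _ : ℝ => (2 * c) ^ 2 / 2) ν := integrable_const _
  have l2' : ∀ x, siteWeight c x ≠ 0 →
      Real.log (siteWeight c x) ≤ (2 * c) ^ 2 / 2 - x ^ 2 / 2 := fun x hx => by
    have := log_siteWeight_le le_rfl hc hx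
    rw [zero_mul, add_zero, zero_add] at this
    exact this
  have l2 : ∀ x, siteWeight c x ≠ 0 → Real.log (siteWeight c x) ≤ (2 * c) ^ 2 / 2 := fun x hx => by
    linarith [l2' x hx, sq_nonneg x]
  have n1 := extIntegral_negLog_ne_bot b1 l1
  have n2 := extIntegral_negLog_ne_bot b2 l2
  have t2 : extIntegral ν (fun x => negLog (siteWeight c x)) ≠ ⊤ := by
    intro ht
    refine h ?_
    rw [ht, EReal.add_top_of_ne_bot]
    generalize extIntegral (ν.prod ν) (fun p : ℝ × ℝ => negLog |p.1 - p.2|) = z at n1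
    induction z with
    | bot => exact absurd rfl n1
    | top => rw [EReal.coe_mul_top_of_pos (by positivity)]; simp
    | coe r => rw [← EReal.coe_mul]; exact EReal.coe_ne_bot _
  have t1 : extIntegral (ν.prod ν) (fun p : ℝ × ℝ => negLog |p.1 - p.2|) ≠ ⊤ := by
    intro ht
    refine h ?_
    rw [ht, EReal.coe_mul_top_of_pos (by positivity), EReal.top_add_of_ne_bot n2]
  obtain ⟨ne1, i1⟩ := of_extIntegral_negLog_ne_top (by fun_prop) b1 l1 t1
  obtain ⟨ne2, i2⟩ := of_extIntegral_negLog_ne_top (continuous_siteWeight hc).measurable b2 l2 t2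
  -- Half of the quadratic term survives in `l2'`, so `x²` is dominated by the integrable potential.
  have hsq : Integrable (fun x : ℝ => x ^ 2) ν := by
    refine (((integrable_const ((2 * c) ^ 2 / 2)).sub i2).const_mul 2).mono' (by fun_prop) ?_
    filter_upwards [ne2] with x hx
    rw [Real.norm_of_nonneg (sq_nonneg x)]
    simp only [Pi.sub_apply]
    linarith [l2' x hx]
  refine ⟨hsq, by simpa using i1, ?_, ?_, ?_⟩
  · filter_upwards [ne1] with p hp using sub_ne_zero.1 (abs_ne_zero.1 hp)
  · by_cases h0 : c = 0
    · exact Or.inl h0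
    · right
      filter_upwards [ne2] with x hx
      exact ((siteWeight_ne_zero_iff c x).1 hx).resolve_left h0
  · by_cases h0 : c = 0
    · exact Or.inl h0
    · right
      refine ((i2.add hsq).const_mul (2 * c)⁻¹).congr ?_
      filter_upwards [ne2] with x hx
      rw [Pi.add_apply, log_siteWeight hc hx]
      field_simp
      ring

theorem hasFiniteEnergy_of_le {M : ℝ≥0∞} (hM : M ≠ ⊤) (hν : ν ≤ M • volume)
    (h2 : Integrable (fun x : ℝ => x ^ 2) ν) (c : ℝ) : HasFiniteEnergy c ν :=
  ⟨h2, integrable_log_sub hM hν h2, ae_ne_of_le hν, Or.inr (ae_ne_zero_of_le hν),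
    Or.inr (integrable_log_of_le hM hν h2)⟩

/-- The interaction is at least `-β ∫ log (1 + |t|) dν`, and the potential dominates `β log (1 +
|t|)` up to a constant. The bound does not depend on `ν`, so the infimum is not `-∞`. -/
theorem HasFiniteEnergy.le_realEnergy (hβ : 0 < β) (hc : 0 ≤ c) (h : HasFiniteEnergy c ν) :
    -((β + 2 * c) ^ 2 / 2) ≤ realEnergy β c ν := by
  have h1 := integrable_log_one_add h.sq
  have hw := h.integrable_log_siteWeight hc
  have e1 : -(2 * ∫ t, Real.log (1 + |t|) ∂ν) ≤ logEnergy ν := by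
    have hi : Integrable (fun p : ℝ × ℝ => Real.log (1 + |p.1|) + Real.log (1 + |p.2|))
      (ν.prod ν) := (h1.comp_fst ν).add (h1.comp_snd ν)
    have heq : ∫ p : ℝ × ℝ, (Real.log (1 + |p.1|) + Real.log (1 + |p.2|)) ∂(ν.prod ν)
        = 2 * ∫ t, Real.log (1 + |t|) ∂ν := by
      rw [integral_add (h1.comp_fst ν) (h1.comp_snd ν),
        integral_fun_fst (fun t : ℝ => Real.log (1 + |t|)),
        integral_fun_snd (fun t : ℝ => Real.log (1 + |t|)), probReal_univ, one_smul]
      ring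
    rw [← heq, ← integral_neg, logEnergy]
    refine integral_mono_ae hi.neg h.log_sub.neg ?_
    filter_upwards [h.ae_ne] with p hp
    have := log_abs_sub_le p.1 p.2 (abs_ne_zero.2 (sub_ne_zero.2 hp))
    rw [Real.log_abs] at this
    linarith
  have e2 : -((β + 2 * c) ^ 2 / 2) + β * ∫ t, Real.log (1 + |t|) ∂ν
      ≤ ∫ x, -Real.log (siteWeight c x) ∂ν := by
    have hi : Integrable (fun x : ℝ => -((β + 2 * c) ^ 2 / 2) + β * Real.log (1 + |x|)) ν :=
      (integrable_const _).add (h1.const_mul β)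
    have heq : ∫ x : ℝ, (-((β + 2 * c) ^ 2 / 2) + β * Real.log (1 + |x|)) ∂ν
        = -((β + 2 * c) ^ 2 / 2) + β * ∫ t, Real.log (1 + |t|) ∂ν := by
      rw [integral_add (integrable_const _) (h1.const_mul β), integral_const, probReal_univ,
        one_smul, integral_const_mul]
    rw [← heq]
    refine integral_mono_ae hi hw.1.neg ?_
    filter_upwards [h.ae_siteWeight_ne_zero] with x hx
    have := log_siteWeight_le hβ.le hc hx
    linarith [sq_nonneg x]
  rw [realEnergy, ← hw.2]
  have := mul_le_mul_of_nonneg_left e1 (show 0 ≤ β / 2 by positivity)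
  linarith

end Energy

/-! ### Finiteness of the minimal energy, near-minimizers, and the concentration estimate. -/

theorem hasFiniteEnergy_unif (c : ℝ) : HasFiniteEnergy c unif := by
  refine hasFiniteEnergy_of_le ENNReal.one_ne_top ?_ ?_ c
  · rw [one_smul]
    exact Measure.restrict_le_self
  · exact (by fun_prop : Continuous fun x : ℝ => x ^ 2).integrableOn_Icc

theorem exists_minEnergy_eq {β c : ℝ} (hβ : 0 < β) (hc : 0 ≤ c) :
    ∃ e : ℝ, minEnergy β c = (e : EReal) := by
  have h1 : minEnergy β c ≤ (realEnergy β c unif : EReal) := by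
    rw [← (hasFiniteEnergy_unif c).energy_eq hc]
    exact iInf_le (fun ν : ProbabilityMeasure ℝ => energy β c (ν : Measure ℝ)) ⟨unif, inferInstance⟩
  have h2 : ((-((β + 2 * c) ^ 2 / 2) : ℝ) : EReal) ≤ minEnergy β c := by
    refine le_iInf fun ν => ?_
    by_cases ht : energy β c (ν : Measure ℝ) = ⊤
    · rw [ht]
      exact le_top
    · have hf := hasFiniteEnergy_of_energy_ne_top hβ hc ht
      rw [hf.energy_eq hc, EReal.coe_le_coe_iff]
      exact hf.le_realEnergy hβ hc
  exact ⟨(minEnergy β c).toReal, (EReal.coe_toReal (ne_top_of_le_ne_top (EReal.coe_ne_top _) h1)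
    (ne_bot_of_le_ne_bot (EReal.coe_ne_bot _) h2)).symm⟩

theorem exists_bounded_density {β c a : ℝ} (hβ : 0 < β) (hc : 0 ≤ c)
    (ha : minEnergy β c < (a : EReal)) :
    ∃ ν : Measure ℝ, IsProbabilityMeasure ν ∧ Integrable (fun x : ℝ => x ^ 2) ν ∧
      realEnergy β c ν < a ∧ ∃ M : ℝ, 0 < M ∧ ν ≤ ENNReal.ofReal M • volume := by
  obtain ⟨ν, hν⟩ := iInf_lt_iff.1 ha
  have hf := hasFiniteEnergy_of_energy_ne_top hβ hc hν.ne_top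
  rw [hf.energy_eq hc, EReal.coe_lt_coe_iff] at hν
  obtain ⟨δ, hδ, hlt⟩ := exists_realEnergy_smooth_lt hβ hc hf.sq hf.log_sub hf.ae_ne hf.ae_ne_zero
    hf.log hν
  exact ⟨smooth ν δ, inferInstance, (integrable_sq_smooth hδ hf.sq).1, hlt, δ⁻¹, by positivity,
    smooth_le hδ⟩

theorem partitionFunction_ne_zero {β : ℝ} (hβ : 0 < β) (μ : ℝ) (n : ℕ) :
    partitionFunction β μ n ≠ 0 := by
  have h1 : unif ≤ (1 : ℝ≥0∞) • volume := by
    rw [one_smul]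
    exact Measure.restrict_le_self
  have h := le_partitionFunction one_ne_zero ENNReal.one_ne_top h1 (hasFiniteEnergy_unif 0).sq hβ μ n
  rw [one_pow, inv_one, one_mul] at h
  exact ((ENNReal.ofReal_pos.2 (Real.exp_pos _)).trans_le h).ne'

theorem isProbabilityMeasure_ensemble {β μ : ℝ} (hβ : 0 < β) (hμ : 0 ≤ μ) {n : ℕ} (hn : 1 ≤ n) :
    IsProbabilityMeasure (ensemble β μ n) := by
  refine ⟨?_⟩
  rw [ensemble, Measure.smul_apply, withDensity_apply _ MeasurableSet.univ, Measure.restrict_univ,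
    smul_eq_mul]
  exact ENNReal.inv_mul_cancel (partitionFunction_ne_zero hβ μ n) (partitionFunction_ne_top hβ hμ hn)

/-- Quotient of the upper bound for the mass by the lower bound for `Z_n`. The `n²` coefficient is
the energy gap; the term `-β / 2 * logEnergy ν` of order `n` comes from having `n (n - 1)` ordered
pairs rather than `n²`. -/
theorem ensemble_compl_le {β α A r : ℝ} (hβ : 0 < β) (hα : 0 ≤ α) (hA : α ≤ A) {n : ℕ}
    (hn : 1 ≤ n) {ν : Measure ℝ} [IsProbabilityMeasure ν] {M : ℝ} (hM : 0 < M)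
    (hν : ν ≤ ENNReal.ofReal M • volume) (h2 : Integrable (fun x : ℝ => x ^ 2) ν) :
    ensemble β (n * α) n {x | Real.exp (-(r * (n : ℝ) ^ 2)) ≤ gibbs β α n x}ᶜ
      ≤ ENNReal.ofReal (Real.exp (n * (n * ((∫ x, x ^ 2 ∂ν) + 2 * (α * ∫ x, -Real.log x ∂ν)
          + β / 2 * logEnergy ν - r)
          + (Real.log (siteMass A) + Real.log M - β / 2 * logEnergy ν)))) := by
  have hn0 : (n : ℝ) ≠ 0 := by positivity
  have hdiv : n * α / n = α := by field_simp
  have hs : MeasurableSet {x | Real.exp (-(r * (n : ℝ) ^ 2)) ≤ gibbs β α n x}ᶜ :=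
    (isClosed_sublevel hβ hα hn _).measurableSet.compl
  have hup := setLIntegral_weight_le (A := A) hβ (μ := n * α) (by positivity) hn
    (by rwa [hdiv]) hs (Real.exp_pos (-(r * (n : ℝ) ^ 2))).le (fun x hx => by
      rw [hdiv]
      exact le_of_not_ge fun h => hx h)
  have hlow := le_partitionFunction (ENNReal.ofReal_pos.2 hM).ne' ENNReal.ofReal_ne_top hν h2 hβ
    (n * α) n
  set H : ℝ := n * (n * ∫ x, x ^ 2 ∂ν) + 2 * (n * α) * (n * ∫ x, -Real.log x ∂ν)
    + β / 2 * (n * (n - 1) * logEnergy ν) with hH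
  have hinv : (partitionFunction β (n * α) n)⁻¹ ≤ ENNReal.ofReal (M ^ n * Real.exp H) := by
    refine (ENNReal.inv_le_inv.2 hlow).trans (le_of_eq ?_)
    rw [← ENNReal.ofReal_pow hM.le, ← ENNReal.ofReal_inv_of_pos (by positivity),
      ← ENNReal.ofReal_mul (by positivity), ← ENNReal.ofReal_inv_of_pos (by positivity), mul_inv,
      inv_inv, Real.exp_neg, inv_inv]
  rw [ensemble, Measure.smul_apply, withDensity_apply _ hs, smul_eq_mul]
  refine (mul_le_mul' hinv hup).trans (le_of_eq ?_)
  rw [← ENNReal.ofReal_mul (by positivity)]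
  congr 1
  have e1 : M ^ n = Real.exp (n * Real.log M) := by rw [Real.exp_nat_mul, Real.exp_log hM]
  have e2 : siteMass A ^ n = Real.exp (n * Real.log (siteMass A)) := by
    rw [Real.exp_nat_mul, Real.exp_log (siteMass_pos A)]
  rw [e1, e2, ← Real.exp_add, ← Real.exp_add, ← Real.exp_add, hH]
  congr 1
  ring

theorem tendsto_ensemble_compl {β c r : ℝ} (hβ : 0 < β) {α : ℕ → ℝ} (hα : ∀ n, 0 ≤ α n)
    (hc : Tendsto α atTop (𝓝 c)) (hr : minEnergy β c < (r : EReal)) :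
    Tendsto (fun n : ℕ => ensemble β (n * α n) n
      {x | Real.exp (-(r * (n : ℝ) ^ 2)) ≤ gibbs β (α n) n x}ᶜ) atTop (𝓝 0) := by
  have hc0 : 0 ≤ c := ge_of_tendsto' hc hα
  -- One `ν`, chosen for the limit `c`, serves all `n`: `α n` enters the gap linearly, so the gap
  -- converges to a negative number.
  obtain ⟨ν, hν, h2, hlt, M, hM, hle⟩ := exists_bounded_density hβ hc0 hr
  have hneg : (∫ x, x ^ 2 ∂ν) + 2 * (c * ∫ x, -Real.log x ∂ν) + β / 2 * logEnergy ν - r < 0 := by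
    rw [realEnergy] at hlt
    linarith
  have t1 : Tendsto (fun n : ℕ => (∫ x, x ^ 2 ∂ν) + 2 * (α n * ∫ x, -Real.log x ∂ν)
      + β / 2 * logEnergy ν - r) atTop
      (𝓝 ((∫ x, x ^ 2 ∂ν) + 2 * (c * ∫ x, -Real.log x ∂ν) + β / 2 * logEnergy ν - r)) :=
    ((((hc.mul_const _).const_mul 2).const_add _).add_const _).sub_const _
  have t2 := tendsto_atBot_add_const_right atTop
    (Real.log (siteMass (c + 1)) + Real.log M - β / 2 * logEnergy ν)
    ((tendsto_natCast_atTop_atTop (R := ℝ)).atTop_mul_neg hneg t1)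
  have t3 := (tendsto_natCast_atTop_atTop (R := ℝ)).atTop_mul_atBot₀ t2
  have t4 := ENNReal.tendsto_ofReal (Real.tendsto_exp_atBot.comp t3)
  rw [ENNReal.ofReal_zero] at t4
  refine tendsto_of_tendsto_of_tendsto_of_le_of_le' tendsto_const_nhds t4
    (Eventually.of_forall fun _ => zero_le) ?_
  filter_upwards [hc.eventually_le_const (lt_add_one c), eventually_ge_atTop 1] with n hA hn
  exact ensemble_compl_le hβ (hα n) hA hn hM hle h2

end ChiralEnsemble
end

theorem proposition5p1 (β c : ℝ) (hβ : 0 < β) (μ : ℕ → ℝ) (hμ : ∀ n, 0 ≤ μ n)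
    (hc : Tendsto (fun n : ℕ => μ n / (n : ℝ)) atTop (𝓝 c)) (ε : ℝ) (hε : 0 < ε) :
    (∀ n : ℕ, 2 ≤ n → IsCompact (ChiralEnsemble.sublevel β c (μ n) ε n)) ∧
      Tendsto (fun n : ℕ =>
          ChiralEnsemble.ensemble β (μ n) n (ChiralEnsemble.sublevel β c (μ n) ε n))
        atTop (𝓝 1) := by
  have hα : ∀ n : ℕ, 0 ≤ μ n / n := fun n => div_nonneg (hμ n) n.cast_nonneg
  have hc0 : 0 ≤ c := ge_of_tendsto' hc hα
  obtain ⟨e, he⟩ := ChiralEnsemble.exists_minEnergy_eq hβ hc0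
  refine ⟨fun n hn => ?_, ?_⟩
  · rw [ChiralEnsemble.sublevel_eq hβ (hμ n) (by omega) he]
    exact ChiralEnsemble.isCompact_sublevel hβ (hα n) hn _
  · have hr : ChiralEnsemble.minEnergy β c < ((e + ε : ℝ) : EReal) := by
      rw [he, EReal.coe_lt_coe_iff]
      linarith
    -- The complement estimate is written with `n * (μ n / n)`, which is `μ n` once `n ≥ 1`.
    have h1 := ENNReal.Tendsto.sub (tendsto_const_nhds (x := (1 : ℝ≥0∞)))
      (ChiralEnsemble.tendsto_ensemble_compl hβ hα hc hr) (Or.inl ENNReal.one_ne_top)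
    rw [tsub_zero] at h1
    refine h1.congr' ?_
    filter_upwards [eventually_ge_atTop 1] with n hn
    have hn0 : (n : ℝ) ≠ 0 := by positivity
    have := ChiralEnsemble.isProbabilityMeasure_ensemble hβ (hμ n) hn
    rw [ChiralEnsemble.sublevel_eq hβ (hμ n) hn he, mul_div_cancel₀ _ hn0,
      ← prob_compl_eq_one_sub (ChiralEnsemble.isClosed_sublevel hβ (hα n) hn _).measurableSet.compl,
      compl_compl]
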